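/- Let $b\ge 2$ and $s\ge 0$ be integers, and let $\omega_b=e^{2\pi i/b}$. For $k\in\mathbb N=\{0,1,2,\dots\}$ write $k=\kappa_1b^{a_1-1}+\dots+\kappa_vb^{a_v-1}$ with $0<\kappa_i<b$ and $a_1>\dots>a_v\ge 1$ (with $v=0$ for $k=0$), and put $v(k)=v$, $\mu(k)=a_1+\dots+a_v$ (so $\mu(0)=0$). For $x\in[0,1)$ with $b$-adic expansion $x=\sum_{i\ge1}\xi_ib^{-i}$, where infinitely many $\xi_i$ differ from $b-1$, let $\mathrm{wal}_k(x)=\omega_b^{\sum_{i=1}^v\kappa_i\xi_{a_i}}$. For $\boldsymbol k=(k_1,\dots,k_s)\in\mathbb N^s$ let $\mu(\boldsymbol k)=\sum_j\mu(k_j)$, $\mathrm{wal}_{\boldsymbol k}(\boldsymbol x)=\prod_j\mathrm{wal}_{k_j}(x_j)$ and $\widehat f(\boldsymbol k)=\int_{[0,1)^s}f(\boldsymbol x)\,\overline{\mathrm{wal}_{\boldsymbol k}(\boldsymbol x)}\,d\boldsymbol x$. Let $$m_b=\min_{1\le c\le b-1}|1-\overline{\omega_b}^{\,c}|=2\sin(\pi/b),\qquad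 M_b=\max_{1\le c\le b-1}|1-\overline{\omega_b}^{\,c}|=\begin{cases}2&b\text{ even},\\ 2\sin\big(\tfrac{(b+1)\pi}{2b}\big)&b\text{ odd},\end{cases}$$ $$C_b=\begin{cases}2&b=2,\\ M_b+\dfrac{b\,m_b}{b-M_b}&b\ne2.\end{cases}$$ Let $f\colon[0,1]^s\to\mathbb C$ be of class $C^\infty$ on the closed cube, let $r_1,\dots,r_s>0$, and assume that there is a real $D>0$ such that $$\|f^{(n_1,\dots,n_s)}\|_{L^1([0,1)^s)}\le D\prod_{j=1}^s r_j^{n_j}\qquad\text{for all }(n_1,\dots,n_s)\in\mathbb N^s,$$ where $f^{(n_1,\dots,n_s)}=(\partial/\partial x_1)^{n_1}\cdots(\partial/\partial x_s)^{n_s}f$. Then for all $\boldsymbol k\in\mathbb N^s$ $$|\widehat f(\boldsymbol k)|\le D\,b^{-\mu(\boldsymbol k)}\prod_{j=1}^s\left(r_jm_b^{-1}\right)^{v(k_j)}C_b^{\min(1,v(k_j))}.$$ In particular, if $r_j=m_b$ for all $1\le j\le s$, then $\widehat f(\boldsymbol k)=O(b^{-\mu(\boldsymbol k)})$, i.e.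 there is a constant $C$ with $|\widehat f(\boldsymbol k)|\le C\,b^{-\mu(\boldsymbol k)}$ for all $\boldsymbol k\in\mathbb N^s$. -/

import Mathlib

open scoped ContDiff

noncomputable section

namespace WalshDecay

/-- The primitive `b`-th root of unity `exp (2 π i / b)`. -/
def omega (b : ℕ) : ℂ := Complex.exp (2 * Real.pi * Complex.I / b)

/-- The `b`-adic digit of `k` at `b ^ i`, so that `k = ∑ i, natDigit b k i * b ^ i`. -/
def natDigit (b k i : ℕ) : ℕ := (Nat.digits b k).getD i 0

/-- The set `{a_1, …, a_v}` of positions of the nonzero `b`-adic digits of `k`, where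
`k = κ_1 b ^ (a_1 - 1) + ⋯ + κ_v b ^ (a_v - 1)` with `0 < κ_i < b` and `a_1 > ⋯ > a_v ≥ 1`. -/
def positions (b k : ℕ) : Finset ℕ :=
  ((Finset.range (Nat.digits b k).length).filter (fun i => natDigit b k i ≠ 0)).image (· + 1)

/-- The Hamming weight `v(k)`: the number of nonzero `b`-adic digits of `k`. -/
def hammingWeight (b k : ℕ) : ℕ := (positions b k).card

/-- `μ(k) = a_1 + ⋯ + a_v`, and `μ(0) = 0`. -/
def mu (b k : ℕ) : ℕ := ∑ a ∈ positions b k, a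

/-- `μ(k_1, …, k_s) = μ(k_1) + ⋯ + μ(k_s)`. -/
def muVec (b : ℕ) {s : ℕ} (k : Fin s → ℕ) : ℕ := ∑ j, mu b (k j)

/-- The `b`-adic `k`-th Walsh function, used on `[0, 1)`. Here `Real.digits x b i` is the digit
`ξ_{i+1}` of the expansion `x = ξ_1 b⁻¹ + ξ_2 b⁻² + ⋯` that does not end in digits `b - 1`. -/
def wal (b : ℕ) [NeZero b] (k : ℕ) (x : ℝ) : ℂ :=
  omega b ^ (∑ a ∈ positions b k, natDigit b k (a - 1) * (Real.digits x b (a - 1) : ℕ))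

/-- The multivariate Walsh function `wal_{k_1}(x_1) ⋯ wal_{k_s}(x_s)`. -/
def walVec (b : ℕ) [NeZero b] {s : ℕ} (k : Fin s → ℕ) (x : Fin s → ℝ) : ℂ :=
  ∏ j, wal b (k j) (x j)

/-- The half-open unit cube `[0, 1)^s`. -/
def unitCube (s : ℕ) : Set (Fin s → ℝ) := Set.univ.pi (fun _ => Set.Ico (0 : ℝ) 1)

/-- The `k`-th Walsh coefficient of `f`. -/
def walshCoeff (b : ℕ) [NeZero b] {s : ℕ} (f : (Fin s → ℝ) → ℂ) (k : Fin s → ℕ) : ℂ :=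
  ∫ x in unitCube s, f x * starRingEnd ℂ (walVec b k x)

/-- The partial derivative `∂g/∂x_j` on the closed cube `[0, 1]^s` (one-sided on its faces). -/
def partialDeriv {s : ℕ} (j : Fin s) (g : (Fin s → ℝ) → ℂ) : (Fin s → ℝ) → ℂ :=
  fun x => derivWithin (fun t : ℝ => g (Function.update x j t)) (Set.Icc 0 1) (x j)

/-- The mixed derivative `f^{(n_1, …, n_s)} = (∂/∂x_1)^{n_1} ⋯ (∂/∂x_s)^{n_s} f`. -/
def mixedDeriv {s : ℕ} (n : Fin s → ℕ) (f : (Fin s → ℝ) → ℂ) : (Fin s → ℝ) → ℂ :=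
  (List.finRange s).foldr (fun j g => (partialDeriv j)^[n j] g) f

/-- The `L¹` norm on `[0, 1)^s`, with values in `[0, ∞]`. -/
def L1norm {s : ℕ} (g : (Fin s → ℝ) → ℂ) : ENNReal :=
  MeasureTheory.eLpNorm g 1 (MeasureTheory.volume.restrict (unitCube s))

/-- `m_b`: the minimum of `|1 - ω̄^c|` over `c = 1, …, b - 1`. -/
def mConst (b : ℕ) : ℝ :=
  sInf ((fun c : ℕ => ‖1 - starRingEnd ℂ (omega b) ^ c‖) '' Set.Ico 1 b)

/-- `M_b`: the maximum of `|1 - ω̄^c|` over `c = 1, …, b - 1`. -/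
def MConst (b : ℕ) : ℝ :=
  sSup ((fun c : ℕ => ‖1 - starRingEnd ℂ (omega b) ^ c‖) '' Set.Ico 1 b)

/-- The constant `C_b`. -/
def CConst (b : ℕ) : ℝ :=
  if b = 2 then 2 else MConst b + b * mConst b / (b - MConst b)

theorem norm_one_sub_omega_pow {b c : ℕ} (hc : c ∈ Set.Ico 1 b) :
    ‖1 - starRingEnd ℂ (omega b) ^ c‖ = 2 * Real.cos (|Real.pi / 2 - Real.pi * c / b|) := by
  obtain ⟨h1, h2⟩ := hc
  have hb : (0 : ℝ) < b := by exact_mod_cast (by omega : 0 < b)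
  have e : 1 - starRingEnd ℂ (omega b) ^ c
      = starRingEnd ℂ (1 - Complex.exp (Complex.I * ((2 * Real.pi * c / b : ℝ) : ℂ))) := by
    rw [map_sub, map_one, ← map_pow, omega, ← Complex.exp_nat_mul]
    congr 3
    push_cast
    ring
  have hs : 0 ≤ Real.sin (Real.pi * c / b) := by
    apply Real.sin_nonneg_of_nonneg_of_le_pi
    · positivity
    · rw [div_le_iff₀ hb]
      have : (c : ℝ) ≤ b := by exact_mod_cast h2.le
      gcongr
  rw [e, Complex.norm_conj, norm_sub_rev, Complex.norm_exp_I_mul_ofReal_sub_one, Real.cos_abs,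
    Real.cos_pi_div_two_sub, show 2 * Real.pi * c / b / 2 = Real.pi * c / b by ring,
    Real.norm_of_nonneg (by positivity)]

/-- The closed form `m_b = 2 sin (π / b)`. -/
theorem mConst_eq {b : ℕ} (hb : 2 ≤ b) : mConst b = 2 * Real.sin (Real.pi / b) := by
  have hb2 : (2 : ℝ) ≤ b := by exact_mod_cast hb
  have hb0 : (0 : ℝ) < b := by linarith
  have hp := Real.pi_pos
  have h1 : Real.pi / b ≤ Real.pi / 2 := by gcongr
  refine IsLeast.csInf_eq ⟨⟨1, ⟨le_rfl, by omega⟩, ?_⟩, ?_⟩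
  · simp only
    rw [norm_one_sub_omega_pow ⟨le_rfl, by omega⟩, Real.cos_abs, Real.cos_pi_div_two_sub]
    simp
  · rintro _ ⟨c, hc, rfl⟩
    have c1 : (1 : ℝ) ≤ c := by exact_mod_cast hc.1
    have c2 : (c : ℝ) + 1 ≤ b := by exact_mod_cast hc.2
    have e1 : Real.pi / b ≤ Real.pi * c / b := by
      gcongr
      nlinarith
    have e2 : Real.pi * c / b ≤ Real.pi - Real.pi / b := by
      rw [le_sub_iff_add_le, ← add_div, div_le_iff₀ hb0]
      nlinarith
    simp only
    rw [norm_one_sub_omega_pow hc, ← Real.cos_pi_div_two_sub]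
    have : |Real.pi / 2 - Real.pi * c / b| ≤ Real.pi / 2 - Real.pi / b := by
      rw [abs_le]
      constructor <;> linarith
    have h3 : 0 < Real.pi / b := by positivity
    have := Real.cos_le_cos_of_nonneg_of_le_pi (abs_nonneg _) (by linarith) this
    linarith

/-- The closed form of `M_b`. -/
theorem MConst_eq {b : ℕ} (hb : 2 ≤ b) :
    MConst b = if Even b then 2 else 2 * Real.sin ((b + 1) * Real.pi / (2 * b)) := by
  have hb2 : (2 : ℝ) ≤ b := by exact_mod_cast hb
  have hb0 : (0 : ℝ) < b := by linarith
  have hp := Real.pi_pos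
  split_ifs with he
  · obtain ⟨d, hd⟩ := he
    have hdb : (b : ℝ) = d + d := by exact_mod_cast hd
    refine IsGreatest.csSup_eq ⟨⟨d, ⟨by omega, by omega⟩, ?_⟩, ?_⟩
    · simp only
      rw [norm_one_sub_omega_pow ⟨by omega, by omega⟩, hdb]
      have hd0 : (d : ℝ) ≠ 0 := by
        intro h
        rw [h] at hdb
        linarith
      have : Real.pi / 2 - Real.pi * d / (d + d) = 0 := by
        field_simp
        ring
      rw [this]
      simp
    · rintro _ ⟨c, hc, rfl⟩
      simp only
      rw [norm_one_sub_omega_pow hc]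
      linarith [Real.cos_le_one |Real.pi / 2 - Real.pi * c / b|]
  · obtain ⟨d, hd⟩ := Nat.not_even_iff_odd.1 he
    have hdb : (b : ℝ) = 2 * d + 1 := by exact_mod_cast hd
    refine IsGreatest.csSup_eq ⟨⟨d + 1, ⟨by omega, by omega⟩, ?_⟩, ?_⟩
    · simp only
      rw [norm_one_sub_omega_pow ⟨by omega, by omega⟩, Real.cos_abs, Real.cos_pi_div_two_sub]
      congr 2
      push_cast
      rw [hdb]
      field_simp
      ring
    · rintro _ ⟨c, hc, rfl⟩
      simp only
      rw [norm_one_sub_omega_pow hc, ← Real.cos_sub_pi_div_two]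
      have e0 : (b + 1) * Real.pi / (2 * b) - Real.pi / 2 = Real.pi / (2 * b) := by
        field_simp
        ring
      have e1 : Real.pi / 2 - Real.pi * c / b = Real.pi / (2 * b) * (b - 2 * c) := by
        field_simp
      have e2 : (1 : ℝ) ≤ |(b : ℝ) - 2 * c| := by
        have : (1 : ℤ) ≤ |(b : ℤ) - 2 * c| := by
          apply Int.one_le_abs
          omega
        exact_mod_cast this
      have c1 : (1 : ℝ) ≤ c := by exact_mod_cast hc.1
      have c2 : (c : ℝ) + 1 ≤ b := by exact_mod_cast hc.2
      have q : 0 < Real.pi / (2 * b) := by positivity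
      have e3 : Real.pi / (2 * b) * b = Real.pi / 2 := by field_simp
      have e4 : |(b : ℝ) - 2 * c| ≤ b := by
        rw [abs_le]
        constructor <;> linarith
      rw [e0, e1, abs_mul, abs_of_pos q]
      have := Real.cos_le_cos_of_nonneg_of_le_pi (x := Real.pi / (2 * b))
        (y := Real.pi / (2 * b) * |(b : ℝ) - 2 * c|) q.le (by nlinarith) (by nlinarith)
      linarith

end WalshDecay

end

noncomputable section

namespace WalshDecay

open MeasureTheory Set

section OneVar

open intervalIntegral

/-! ### Functions with a multiplicative translation law -/

/-! On `[0, 1)` the conjugate of `wal b k` is the product, over the positions `a` of the nonzero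
digits, of the step characters `x ↦ z_a ^ ⌊b ^ a * x⌋`, where `z_a ≠ 1` and `z_a ^ b = 1`.
Integrating by parts once per position, the finest (largest `a`) first, moves `v(k)` derivatives
onto the function and leaves an iterated primitive, `walshPrimitive`, as kernel
(`integral_mul_charProd`). By Fubini this can be done one coordinate at a time
(`integral_mul_prod_eq`). The coefficient is then at most the `L¹` norm of a mixed derivative times
the sup norms of the kernels, so everything rests on `norm_walshPrimitive_le`.

Let `W` be the kernel built so far, with period `p = b ^ (-a)` and mean `l`, and let `F` be the
primitive of the step character times `W`. Then `F (x + p) = p * l + z * F x`. Hence `F` has period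
`b * p` and mean `p * l / (1 - z)`, which yields the factor `b ^ (-a) / m_b` of each position.
Moreover `F` vanishes at the multiples of `b * p`; these include the endpoints and all jumps of the
coarser characters, so no boundary terms arise.

Estimating sup norms at every stage would cost a constant per digit. Instead the induction carries
the mean `l` and a bound `|l| * p * b / (b - M_b)` for the primitive of `W - l`. This bound
reproduces itself (`norm_meanDeviation_walshPrimitive_le`). The sup norm is estimated only at the
last, coarsest position, which is why `C_b` appears once. For `b = 2` the kernels are nonnegative,
and monotonicity gives the bound directly. -/

theorem translate_zpow {V : ℝ → ℂ} {p : ℝ} {z : ℂ} (hz : z ≠ 0)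
    (h : ∀ x, V (x + p) = z * V x) (c : ℤ) (x : ℝ) : V (x + c * p) = z ^ c * V x := by
  induction c with
  | zero => simp
  | succ n ih =>
    rw [show x + ((n + 1 : ℤ) : ℝ) * p = x + ((n : ℤ) : ℝ) * p + p by push_cast; ring, h, ih,
      zpow_add_one₀ hz]
    ring
  | pred n ih =>
    have := h (x + ((-(n : ℤ) - 1 : ℤ) : ℝ) * p)
    rw [show x + ((-(n : ℤ) - 1 : ℤ) : ℝ) * p + p = x + ((-(n : ℤ) : ℤ) : ℝ) * p by
      push_cast; ring, ih] at this
    rw [zpow_sub_one₀ hz, mul_right_comm, this]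
    field_simp

theorem exists_floor_decomp {p : ℝ} (hp : 0 < p) (x : ℝ) :
    ∃ (c : ℤ) (u : ℝ), u ∈ Ico 0 p ∧ x = u + c * p := by
  refine ⟨⌊x / p⌋, x - ⌊x / p⌋ * p, ⟨?_, ?_⟩, by ring⟩
  · have := (le_div_iff₀ hp).1 (Int.floor_le (x / p))
    linarith
  · have := (div_lt_iff₀ hp).1 (Int.lt_floor_add_one (x / p))
    linarith

theorem ne_zero_of_norm_one {z : ℂ} (hz : ‖z‖ = 1) : z ≠ 0 := by
  rintro rfl
  simp at hz

/-- `J / (1 - z)` is the fixed point of `w ↦ J + z * w`; after subtracting it, the translation law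
becomes purely multiplicative. -/
theorem affine_translate_eq {F : ℝ → ℂ} {p : ℝ} {z J : ℂ} (hz : z ≠ 0) (hz1 : z ≠ 1)
    (hF : ∀ x, F (x + p) = J + z * F x) (c : ℤ) (x : ℝ) :
    F (x + c * p) = J / (1 - z) * (1 - z ^ c) + z ^ c * F x := by
  have h1 : 1 - z ≠ 0 := sub_ne_zero.2 hz1.symm
  have := translate_zpow (V := fun x => F x - J / (1 - z)) hz
    (fun x => by rw [hF]; field_simp; ring) c x
  beta_reduce at this
  linear_combination this

/-- A function with `F (x + p) = J + z F x` is controlled by its deviation from linear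
interpolation on `[0, p]`. -/
theorem norm_le_of_affine_translate {F : ℝ → ℂ} {p : ℝ} (hp : 0 < p) {z J : ℂ} (hz : ‖z‖ = 1)
    (hz1 : z ≠ 1) (hF : ∀ x, F (x + p) = J + z * F x) {M : ℝ} (hM : ∀ c : ℤ, ‖1 - z ^ c‖ ≤ M)
    {δ : ℝ} (hδ : ∀ u ∈ Icc 0 p, ‖F u - (u / p : ℝ) * J‖ ≤ δ) (x : ℝ) :
    ‖F x‖ ≤ ‖J‖ / ‖1 - z‖ * M + δ := by
  have hz0 := ne_zero_of_norm_one hz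
  have h1 : 1 - z ≠ 0 := sub_ne_zero.2 hz1.symm
  obtain ⟨c, u, hu, rfl⟩ := exists_floor_decomp hp x
  have t0 : 0 ≤ u / p := div_nonneg hu.1 hp.le
  have t1 : u / p ≤ 1 := (div_le_one hp).2 hu.2.le
  -- The bracket interpolates linearly between the values at the nodes `c * p` and `(c + 1) * p`
  -- that start value `0` would give; the last term is the deviation on the first cell, rotated by
  -- `z ^ c`.
  have key : F (u + c * p) = J / (1 - z) * (((1 - u / p : ℝ) : ℂ) * (1 - z ^ c)
      + ((u / p : ℝ) : ℂ) * (1 - z ^ (c + 1))) + z ^ c * (F u - (u / p : ℝ) * J) := by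
    rw [affine_translate_eq hz0 hz1 hF, zpow_add_one₀ hz0]
    push_cast
    field_simp
    ring
  rw [key]
  refine (norm_add_le _ _).trans (add_le_add ?_ ?_)
  · rw [norm_mul, norm_div]
    gcongr
    refine (norm_add_le _ _).trans ?_
    rw [norm_mul, norm_mul, Complex.norm_real, Complex.norm_real, Real.norm_of_nonneg t0,
      Real.norm_of_nonneg (by linarith)]
    nlinarith [hM c, hM (c + 1)]
  · rw [norm_mul, norm_zpow, hz, one_zpow, one_mul]
    exact hδ u ⟨hu.1, hu.2.le⟩

theorem integral_affine_translate {h : ℝ → ℂ} {p : ℝ} {z : ℂ}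
    (hi : ∀ a b, IntervalIntegrable h volume a b) (ht : ∀ x, h (x + p) = z * h x) (x : ℝ) :
    ∫ t in 0..(x + p), h t = (∫ t in 0..p, h t) + z * ∫ t in 0..x, h t := by
  rw [← integral_add_adjacent_intervals (hi 0 p) (hi p (x + p)), ← intervalIntegral.integral_const_mul]
  congr 1
  simp_rw [← ht]
  rw [intervalIntegral.integral_comp_add_right, zero_add]

theorem affine_translate_periodic {F : ℝ → ℂ} {p : ℝ} {z J : ℂ} {b : ℕ} (hzb : z ^ b = 1)
    (hz : z ≠ 0) (hz1 : z ≠ 1) (hF : ∀ x, F (x + p) = J + z * F x) :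
    Function.Periodic F (b * p) := by
  intro x
  have := affine_translate_eq hz hz1 hF b x
  simpa [hzb] using this

/-- The integral of a bounded function whose primitive is periodic. -/
theorem norm_integral_le_half_period {h : ℝ → ℂ} {q K : ℝ} (hq : 0 < q)
    (hi : ∀ a b, IntervalIntegrable h volume a b)
    (hper : Function.Periodic (fun x => ∫ t in 0..x, h t) q) (hK : ∀ x, ‖h x‖ ≤ K) (x : ℝ) :
    ‖∫ t in 0..x, h t‖ ≤ q / 2 * K := by
  obtain ⟨c, u, hu, rfl⟩ := exists_floor_decomp hq x
  have e1 : ∫ t in 0..(u + c * q), h t = ∫ t in 0..u, h t := hper.int_mul c u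
  have e2 : ∫ t in 0..q, h t = 0 := by simpa using hper 0
  rw [e1]
  have hK0 : 0 ≤ K := (norm_nonneg _).trans (hK 0)
  have b1 : ‖∫ t in 0..u, h t‖ ≤ K * |u - 0| :=
    intervalIntegral.norm_integral_le_of_norm_le_const fun t _ => hK t
  -- The integral over a full period is zero, so the integral up to `u` is also minus the integral
  -- from `u` to `q`. Averaging the two estimates gives half the period.
  have b2 : ‖∫ t in u..q, h t‖ ≤ K * |q - u| :=
    intervalIntegral.norm_integral_le_of_norm_le_const fun t _ => hK t
  rw [← integral_add_adjacent_intervals (hi 0 u) (hi u q)] at e2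
  rw [eq_neg_of_add_eq_zero_right e2, norm_neg, abs_of_nonneg (by linarith [hu.2])] at b2
  rw [sub_zero, abs_of_nonneg hu.1] at b1
  linarith

/-! ### Step characters and their primitives -/

/-- The step function `x ↦ z ^ ⌊x / p⌋`. -/
def stepChar (z : ℂ) (p x : ℝ) : ℂ := z ^ ⌊x / p⌋

theorem norm_stepChar {z : ℂ} (hz : ‖z‖ = 1) (p x : ℝ) : ‖stepChar z p x‖ = 1 := by
  rw [stepChar, norm_zpow, hz, one_zpow]

theorem measurable_stepChar (z : ℂ) (p : ℝ) : Measurable (stepChar z p) :=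
  (measurable_from_top (f := fun n : ℤ => z ^ n)).comp (measurable_id.div_const p).floor

theorem stepChar_add {z : ℂ} {p : ℝ} (hz : z ≠ 0) (hp : 0 < p) (x : ℝ) :
    stepChar z p (x + p) = z * stepChar z p x := by
  rw [stepChar, stepChar, add_div, div_self hp.ne', Int.floor_add_one, zpow_add_one₀ hz, mul_comm]

theorem stepChar_of_mem_Ico {z : ℂ} {p x : ℝ} (hx : x ∈ Ico 0 p) : stepChar z p x = 1 := by
  have hp : 0 < p := hx.1.trans_lt hx.2
  have : ⌊x / p⌋ = 0 := Int.floor_eq_zero_iff.2 ⟨div_nonneg hx.1 hp.le, (div_lt_one hp).2 hx.2⟩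
  rw [stepChar, this, zpow_zero]

theorem stepChar_eventuallyEq {z : ℂ} {p x : ℝ} (hx : ∀ n : ℤ, x / p ≠ n) :
    ∀ᶠ y in nhds x, stepChar z p y = stepChar z p x := by
  have hc : ContinuousAt (fun y : ℝ => y / p) x := by fun_prop
  have h1 : ∀ᶠ y in nhds x, (⌊x / p⌋ : ℝ) < y / p :=
    hc.eventually (lt_mem_nhds ((Int.floor_le _).lt_of_ne (hx _).symm))
  have h2 : ∀ᶠ y in nhds x, y / p < ⌊x / p⌋ + 1 :=
    hc.eventually (gt_mem_nhds (Int.lt_floor_add_one _))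
  filter_upwards [h1, h2] with y hy1 hy2
  rw [stepChar, stepChar, Int.floor_eq_iff.2 ⟨hy1.le, hy2⟩]

theorem intervalIntegrable_stepChar_mul {z : ℂ} (hz : ‖z‖ = 1) (p : ℝ) {W : ℝ → ℂ}
    (hW : Continuous W) (a b : ℝ) :
    IntervalIntegrable (fun t => stepChar z p t * W t) volume a b :=
  have h {s : Set ℝ} (hs : IntegrableOn W s volume) :
      IntegrableOn (fun t => stepChar z p t * W t) s volume :=
    Integrable.bdd_mul (c := 1) hs (measurable_stepChar z p).aestronglyMeasurable
      (Filter.Eventually.of_forall fun x => (norm_stepChar hz p x).le)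
  ⟨h (hW.intervalIntegrable a b).1, h (hW.intervalIntegrable a b).2⟩

/-- The primitive of `W` times a step character that vanishes at `0`. -/
def charPrimitive (z : ℂ) (p : ℝ) (W : ℝ → ℂ) (x : ℝ) : ℂ := ∫ t in 0..x, stepChar z p t * W t

section charPrimitive

variable {z : ℂ} {p : ℝ} {W : ℝ → ℂ}

theorem charPrimitive_of_mem_Icc {u : ℝ} (hu : u ∈ Icc 0 p) :
    charPrimitive z p W u = ∫ t in 0..u, W t := by
  refine intervalIntegral.integral_congr_Ioo_of_le hu.1 fun t ht => ?_
  rw [stepChar_of_mem_Ico ⟨ht.1.le, ht.2.trans_le hu.2⟩, one_mul]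

theorem stepChar_mul_add (hz : ‖z‖ = 1) (hp : 0 < p) (hper : Function.Periodic W p) (x : ℝ) :
    stepChar z p (x + p) * W (x + p) = z * (stepChar z p x * W x) := by
  rw [stepChar_add (ne_zero_of_norm_one hz) hp, hper]
  ring

theorem charPrimitive_add (hz : ‖z‖ = 1) (hp : 0 < p) (hW : Continuous W)
    (hper : Function.Periodic W p) (x : ℝ) :
    charPrimitive z p W (x + p) = (∫ t in 0..p, W t) + z * charPrimitive z p W x := by
  rw [← charPrimitive_of_mem_Icc (z := z) (right_mem_Icc.2 hp.le)]
  exact integral_affine_translate (intervalIntegrable_stepChar_mul hz p hW)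
    (stepChar_mul_add hz hp hper) x

theorem continuous_charPrimitive (hz : ‖z‖ = 1) (hW : Continuous W) :
    Continuous (charPrimitive z p W) :=
  continuous_primitive (intervalIntegrable_stepChar_mul hz p hW) 0

theorem charPrimitive_zero : charPrimitive z p W 0 = 0 := intervalIntegral.integral_same

theorem hasDerivAt_charPrimitive (hz : ‖z‖ = 1) (hW : Continuous W) {x : ℝ}
    (hx : ∀ n : ℤ, x / p ≠ n) :
    HasDerivAt (charPrimitive z p W) (stepChar z p x * W x) x := by
  refine integral_hasDerivAt_right (intervalIntegrable_stepChar_mul hz p hW 0 x) ?_ ?_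
  · exact ((measurable_stepChar z p).mul hW.measurable).stronglyMeasurable.stronglyMeasurableAtFilter
  · have h1 : ContinuousAt (stepChar z p) x := by
      refine ContinuousAt.congr (f := fun _ => stepChar z p x) continuousAt_const ?_
      filter_upwards [stepChar_eventuallyEq (z := z) hx] with y hy using hy.symm
    exact h1.mul hW.continuousAt

variable {b : ℕ}

theorem periodic_charPrimitive (hz : ‖z‖ = 1) (hz1 : z ≠ 1) (hzb : z ^ b = 1) (hp : 0 < p)
    (hW : Continuous W) (hper : Function.Periodic W p) :
    Function.Periodic (charPrimitive z p W) (b * p) :=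
  affine_translate_periodic hzb (ne_zero_of_norm_one hz) hz1 (charPrimitive_add hz hp hW hper)

/-- These zeros later cancel the jumps of the coarser characters and the boundary terms. -/
theorem charPrimitive_int_mul (hz : ‖z‖ = 1) (hz1 : z ≠ 1) (hzb : z ^ b = 1) (hp : 0 < p)
    (hW : Continuous W) (hper : Function.Periodic W p) (n : ℤ) :
    charPrimitive z p W (n * (b * p)) = 0 := by
  have := (periodic_charPrimitive hz hz1 hzb hp hW hper).int_mul n 0
  rwa [zero_add, charPrimitive_zero] at this

end charPrimitive

/-! ### Deviation from the mean -/

/-- The primitive of `W - l` that vanishes at `0`. -/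
def meanDeviation (W : ℝ → ℂ) (l : ℂ) (x : ℝ) : ℂ := (∫ t in 0..x, W t) - x * l

theorem continuous_meanDeviation {W : ℝ → ℂ} (hW : Continuous W) (l : ℂ) :
    Continuous (meanDeviation W l) := by
  have := continuous_primitive (fun a b => hW.intervalIntegrable (μ := volume) a b) 0
  unfold meanDeviation
  fun_prop

theorem meanDeviation_zero (W : ℝ → ℂ) (l : ℂ) : meanDeviation W l 0 = 0 := by
  simp [meanDeviation]

theorem periodic_meanDeviation {W : ℝ → ℂ} {l : ℂ} {p : ℝ} (hW : Continuous W)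
    (hper : Function.Periodic W p) (hl : ∫ t in 0..p, W t = p * l) :
    Function.Periodic (meanDeviation W l) p := by
  intro x
  have := integral_affine_translate (z := 1) (p := p) (fun a b => hW.intervalIntegrable a b)
    (fun x => by rw [hper, one_mul]) x
  rw [meanDeviation, meanDeviation, this, hl]
  push_cast
  ring

/-- The part of `charPrimitive z p W` minus its mean which does not come from `meanDeviation W l`:
a piecewise linear function. -/
def linearPart (z : ℂ) (p : ℝ) (W : ℝ → ℂ) (l : ℂ) (x : ℝ) : ℂ :=
  charPrimitive z p W x - p * l / (1 - z) - stepChar z p x * meanDeviation W l x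

/-! ### One primitive: propagation of mean, deviation and sup norm -/

section step

variable {z : ℂ} {p : ℝ} {W : ℝ → ℂ} {l : ℂ} {b : ℕ} {M ε : ℝ}

theorem intervalIntegrable_linearPart (hz : ‖z‖ = 1) (hW : Continuous W) (a c : ℝ) :
    IntervalIntegrable (linearPart z p W l) volume a c :=
  (((continuous_charPrimitive hz hW).sub continuous_const).intervalIntegrable a c).sub
    (intervalIntegrable_stepChar_mul hz p (continuous_meanDeviation hW l) a c)

theorem linearPart_add (hz : ‖z‖ = 1) (hz1 : z ≠ 1) (hp : 0 < p) (hW : Continuous W)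
    (hper : Function.Periodic W p) (hl : ∫ t in 0..p, W t = p * l) (x : ℝ) :
    linearPart z p W l (x + p) = z * linearPart z p W l x := by
  have h1 : 1 - z ≠ 0 := sub_ne_zero.2 hz1.symm
  rw [linearPart, linearPart, charPrimitive_add hz hp hW hper, hl,
    stepChar_add (ne_zero_of_norm_one hz) hp, periodic_meanDeviation hW hper hl]
  field_simp
  ring

theorem linearPart_of_mem_Icc (hW : Continuous W)
    (hper : Function.Periodic W p) (hl : ∫ t in 0..p, W t = p * l) {u : ℝ} (hu : u ∈ Icc 0 p) :
    linearPart z p W l u = u * l - p * l / (1 - z) := by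
  rw [linearPart, charPrimitive_of_mem_Icc hu]
  -- At `u = p` the character has already jumped to `z`, but there the deviation vanishes, so the
  -- formula survives.
  rcases eq_or_lt_of_le hu.2 with rfl | h
  · have := periodic_meanDeviation hW hper hl 0
    rw [zero_add, meanDeviation_zero] at this
    rw [this, hl]
    ring
  · rw [stepChar_of_mem_Ico ⟨hu.1, h⟩, meanDeviation]
    ring

/-- Up to a power of `z`, the values on a cell are `-(p * l / (1 - z))` times a point of the chord
from `1` to `z`, which lies in the unit disc. -/
theorem norm_linearPart_le (hz : ‖z‖ = 1) (hz1 : z ≠ 1) (hp : 0 < p) (hW : Continuous W)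
    (hper : Function.Periodic W p) (hl : ∫ t in 0..p, W t = p * l) (x : ℝ) :
    ‖linearPart z p W l x‖ ≤ ‖p * l / (1 - z)‖ := by
  have h1 : 1 - z ≠ 0 := sub_ne_zero.2 hz1.symm
  obtain ⟨c, u, hu, rfl⟩ := exists_floor_decomp hp x
  have t0 : 0 ≤ u / p := div_nonneg hu.1 hp.le
  have t1 : u / p ≤ 1 := (div_le_one hp).2 hu.2.le
  have hp' : (p : ℂ) ≠ 0 := by exact_mod_cast hp.ne'
  have e : (u * l - p * l / (1 - z) : ℂ)
      = -(p * l / (1 - z)) * (((1 - u / p : ℝ) : ℂ) + ((u / p : ℝ) : ℂ) * z) := by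
    push_cast
    field_simp
    ring
  rw [translate_zpow (ne_zero_of_norm_one hz) (linearPart_add hz hz1 hp hW hper hl),
    linearPart_of_mem_Icc hW hper hl ⟨hu.1, hu.2.le⟩, norm_mul, norm_zpow, hz, one_zpow,
    one_mul, e, norm_mul, norm_neg]
  refine mul_le_of_le_one_right (norm_nonneg _) ((norm_add_le _ _).trans ?_)
  rw [norm_mul, Complex.norm_real, Complex.norm_real, Real.norm_of_nonneg t0,
    Real.norm_of_nonneg (by linarith), hz]
  linarith

theorem integral_linearPart_add (hz : ‖z‖ = 1) (hz1 : z ≠ 1) (hp : 0 < p) (hW : Continuous W)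
    (hper : Function.Periodic W p) (hl : ∫ t in 0..p, W t = p * l) (x : ℝ) :
    ∫ t in 0..(x + p), linearPart z p W l t
      = (∫ t in 0..p, linearPart z p W l t) + z * ∫ t in 0..x, linearPart z p W l t :=
  integral_affine_translate (intervalIntegrable_linearPart hz hW)
    (linearPart_add hz hz1 hp hW hper hl) x

/-- The crude estimate, sufficient for `b ≥ 4`. -/
theorem norm_integral_linearPart_le_half (hz : ‖z‖ = 1) (hz1 : z ≠ 1) (hb : b ≠ 0)
    (hzb : z ^ b = 1) (hp : 0 < p)
    (hW : Continuous W) (hper : Function.Periodic W p) (hl : ∫ t in 0..p, W t = p * l) (x : ℝ) :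
    ‖∫ t in 0..x, linearPart z p W l t‖ ≤ b * p / 2 * ‖p * l / (1 - z)‖ := by
  have hb : (0 : ℝ) < b := by exact_mod_cast Nat.pos_of_ne_zero hb
  exact norm_integral_le_half_period (by positivity) (intervalIntegrable_linearPart hz hW)
    (affine_translate_periodic hzb (ne_zero_of_norm_one hz) hz1
      (integral_linearPart_add hz hz1 hp hW hper hl))
    (norm_linearPart_le hz hz1 hp hW hper hl) x

theorem integral_linearPart_of_mem_Icc (hW : Continuous W)
    (hper : Function.Periodic W p) (hl : ∫ t in 0..p, W t = p * l) {u : ℝ} (hu : u ∈ Icc 0 p) :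
    ∫ t in 0..u, linearPart z p W l t = u ^ 2 / 2 * l - u * (p * l / (1 - z)) := by
  rw [intervalIntegral.integral_congr (g := fun t : ℝ => (t : ℂ) * l - p * l / (1 - z))]
  · rw [intervalIntegral.integral_sub, intervalIntegral.integral_mul_const,
      intervalIntegral.integral_const, intervalIntegral.integral_ofReal, integral_id]
    · simp
    · exact Continuous.intervalIntegrable (by fun_prop) _ _
    · exact Continuous.intervalIntegrable (by fun_prop) _ _
  · intro t ht
    rw [uIcc_of_le hu.1] at ht
    exact linearPart_of_mem_Icc hW hper hl ⟨ht.1, ht.2.trans hu.2⟩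

/-- The finer estimate needed for `b = 3`: on the first cell the integral is a quadratic, whose
deviation from its chord is explicit. -/
theorem norm_integral_linearPart_le (hz : ‖z‖ = 1) (hz1 : z ≠ 1) (hp : 0 < p)
    (hW : Continuous W) (hper : Function.Periodic W p) (hl : ∫ t in 0..p, W t = p * l)
    (hM : ∀ c : ℤ, ‖1 - z ^ c‖ ≤ M) (x : ℝ) :
    ‖∫ t in 0..x, linearPart z p W l t‖ ≤
      p * ‖p * l / (1 - z)‖ * (‖1 + z‖ / 2 * (M / ‖1 - z‖) + ‖1 - z‖ / 8) := by
  have h1 : 1 - z ≠ 0 := sub_ne_zero.2 hz1.symm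
  have h1' : ‖1 - z‖ ≠ 0 := norm_ne_zero_iff.2 h1
  have hp' : (p : ℂ) ≠ 0 := by exact_mod_cast hp.ne'
  have hJ : ∫ t in 0..p, linearPart z p W l t = -(p * (p * l / (1 - z)) * ((1 + z) / 2)) := by
    rw [integral_linearPart_of_mem_Icc hW hper hl (right_mem_Icc.2 hp.le)]
    field_simp
    ring
  refine (norm_le_of_affine_translate (F := fun x => ∫ t in 0..x, linearPart z p W l t)
    (δ := p * ‖p * l / (1 - z)‖ * (‖1 - z‖ / 8)) hp hz hz1
    (integral_linearPart_add hz hz1 hp hW hper hl) hM ?_ x).trans (le_of_eq ?_)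
  · intro u hu
    have e : (u ^ 2 / 2 * l - u * (p * l / (1 - z)) : ℂ) -
        (u / p : ℝ) * -(p * (p * l / (1 - z)) * ((1 + z) / 2))
        = ((u * (u - p) / 2 / p : ℝ) : ℂ) * ((p * l / (1 - z)) * (1 - z)) := by
      push_cast
      field_simp
      ring
    rw [hJ, integral_linearPart_of_mem_Icc hW hper hl hu, e, norm_mul, norm_mul,
      Complex.norm_real]
    -- The maximum is attained at the midpoint `u = p / 2`.
    have : ‖u * (u - p) / 2 / p‖ ≤ p / 8 := by
      rw [Real.norm_eq_abs, abs_le, le_div_iff₀ hp, div_le_iff₀ hp]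
      constructor <;> nlinarith [hu.1, hu.2, sq_nonneg (u - p / 2)]
    calc _ ≤ p / 8 * (‖p * l / (1 - z)‖ * ‖1 - z‖) := by gcongr
      _ = _ := by ring
  · rw [hJ, norm_neg, norm_mul, norm_mul, Complex.norm_real, Real.norm_of_nonneg hp.le,
      norm_div (1 + z), Complex.norm_ofNat]
    field_simp

/-- With `t = u / p`, the deviation from the chord is `(1 - t) * ∫₀ᵘ E - t * ∫ᵤᵖ E`, of norm at most
`2 * t * (1 - t) * p * ε ≤ p * ε / 2`. -/
theorem integral_stepChar_mul_le (hz : ‖z‖ = 1) (hz1 : z ≠ 1) (hp : 0 < p) {E : ℝ → ℂ}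
    (hE : Continuous E) (hper : Function.Periodic E p) (hε : ∀ x, ‖E x‖ ≤ ε)
    (hM : ∀ c : ℤ, ‖1 - z ^ c‖ ≤ M) (x : ℝ) :
    ‖charPrimitive z p E x‖ ≤ p * ε * (M / ‖1 - z‖ + 1 / 2) := by
  have h1' : ‖1 - z‖ ≠ 0 := norm_ne_zero_iff.2 (sub_ne_zero.2 hz1.symm)
  have hM0 : 0 ≤ M := (norm_nonneg _).trans (hM 0)
  have hε0 : 0 ≤ ε := (norm_nonneg _).trans (hε 0)
  have bd (a c : ℝ) (hac : a ≤ c) : ‖∫ t in a..c, E t‖ ≤ ε * (c - a) := by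
    have : ‖∫ t in a..c, E t‖ ≤ ε * |c - a| :=
      intervalIntegral.norm_integral_le_of_norm_le_const fun t _ => hε t
    rwa [abs_of_nonneg (by linarith)] at this
  refine (norm_le_of_affine_translate (δ := p * ε * (1 / 2)) hp hz hz1
    (charPrimitive_add hz hp hE hper) hM ?_ x).trans ?_
  · intro u hu
    have t0 : 0 ≤ u / p := div_nonneg hu.1 hp.le
    have t1 : 0 ≤ 1 - u / p := sub_nonneg.2 ((div_le_one hp).2 hu.2)
    rw [charPrimitive_of_mem_Icc hu, ← integral_add_adjacent_intervals
      (hE.intervalIntegrable 0 u) (hE.intervalIntegrable u p)]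
    have e : (∫ t in 0..u, E t) - (u / p : ℝ) * ((∫ t in 0..u, E t) + ∫ t in u..p, E t)
        = ((1 - u / p : ℝ) : ℂ) * (∫ t in 0..u, E t) - ((u / p : ℝ) : ℂ) * ∫ t in u..p, E t := by
      push_cast
      ring
    rw [e]
    refine (norm_sub_le _ _).trans ?_
    rw [norm_mul, norm_mul, Complex.norm_real, Complex.norm_real, Real.norm_of_nonneg t0,
      Real.norm_of_nonneg t1]
    calc _ ≤ (1 - u / p) * (ε * (u - 0)) + u / p * (ε * (p - u)) := by
          gcongr
          · exact bd 0 u hu.1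
          · exact bd u p hu.2
      _ = p * ε * (2 * (u / p) * (1 - u / p)) := by
          field_simp
          ring
      _ ≤ _ := by
          gcongr
          nlinarith [sq_nonneg (u / p - 1 / 2)]
  · have := bd 0 p hp.le
    calc _ ≤ ε * (p - 0) / ‖1 - z‖ * M + p * ε * (1 / 2) := by gcongr
      _ = _ := by ring

/-- After subtraction of `p * l / (1 - z)`, a shift by `p` multiplies the function by `z`; its
integral over `b` consecutive cells then vanishes because `z ^ b = 1` and `z ≠ 1`. -/
theorem integral_charPrimitive_period (hz : ‖z‖ = 1) (hz1 : z ≠ 1) (hzb : z ^ b = 1) (hp : 0 < p)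
    (hW : Continuous W) (hper : Function.Periodic W p) (hl : ∫ t in 0..p, W t = p * l) :
    ∫ t in 0..(b * p), charPrimitive z p W t = (b * p : ℝ) * (p * l / (1 - z)) := by
  have h1 : 1 - z ≠ 0 := sub_ne_zero.2 hz1.symm
  have hc := continuous_charPrimitive (p := p) hz hW
  have hi (a c : ℝ) : IntervalIntegrable (fun t => charPrimitive z p W t - p * l / (1 - z))
      volume a c := (hc.sub continuous_const).intervalIntegrable a c
  have := affine_translate_periodic (F := fun x => ∫ t in 0..x, (charPrimitive z p W t -
    p * l / (1 - z))) hzb (ne_zero_of_norm_one hz) hz1 (integral_affine_translate (z := z) (p := p) hi fun x => by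
      rw [charPrimitive_add hz hp hW hper, hl]; field_simp; ring) 0
  beta_reduce at this
  rw [zero_add, intervalIntegral.integral_same, intervalIntegral.integral_sub
    (hc.intervalIntegrable _ _) (by simp), intervalIntegral.integral_const, sub_zero,
    sub_eq_zero] at this
  rw [this, Complex.real_smul]

/-- On the first cell the deviation of the primitive from its chord is exactly `meanDeviation W l`.
-/
theorem norm_charPrimitive_le (hz : ‖z‖ = 1) (hz1 : z ≠ 1) (hp : 0 < p)
    (hW : Continuous W) (hper : Function.Periodic W p) (hl : ∫ t in 0..p, W t = p * l)
    (hM : ∀ c : ℤ, ‖1 - z ^ c‖ ≤ M) (hε : ∀ x, ‖meanDeviation W l x‖ ≤ ε) (x : ℝ) :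
    ‖charPrimitive z p W x‖ ≤ ‖p * l / (1 - z)‖ * M + ε := by
  rw [norm_div, ← hl]
  refine norm_le_of_affine_translate hp hz hz1 (charPrimitive_add hz hp hW hper) hM ?_ x
  intro u hu
  have hp' : (p : ℂ) ≠ 0 := by exact_mod_cast hp.ne'
  have := hε u
  rwa [meanDeviation, show (u : ℂ) * l = (u / p : ℝ) * ∫ t in 0..p, W t by
    rw [hl]; push_cast; field_simp, ← charPrimitive_of_mem_Icc (z := z) hu] at this

/-- The primitive minus its mean is `linearPart` plus the step character times `meanDeviation W l`;
the two integrals are bounded separately. -/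
theorem norm_meanDeviation_charPrimitive_le (hz : ‖z‖ = 1) (hz1 : z ≠ 1) (hp : 0 < p)
    (hW : Continuous W) (hper : Function.Periodic W p) (hl : ∫ t in 0..p, W t = p * l)
    (hM : ∀ c : ℤ, ‖1 - z ^ c‖ ≤ M) (hε : ∀ x, ‖meanDeviation W l x‖ ≤ ε) {K : ℝ}
    (hK : ∀ x, ‖∫ t in 0..x, linearPart z p W l t‖ ≤ K) (x : ℝ) :
    ‖meanDeviation (charPrimitive z p W) (p * l / (1 - z)) x‖ ≤
      K + p * ε * (M / ‖1 - z‖ + 1 / 2) := by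
  have hc := continuous_charPrimitive (p := p) hz hW
  have e : meanDeviation (charPrimitive z p W) (p * l / (1 - z)) x
      = (∫ t in 0..x, linearPart z p W l t) + charPrimitive z p (meanDeviation W l) x := by
    rw [charPrimitive, ← intervalIntegral.integral_add (intervalIntegrable_linearPart hz hW _ _)
      (intervalIntegrable_stepChar_mul hz p (continuous_meanDeviation hW l) _ _)]
    simp_rw [linearPart, sub_add_cancel]
    rw [intervalIntegral.integral_sub (hc.intervalIntegrable _ _) (by simp),
      intervalIntegral.integral_const, meanDeviation, sub_zero, Complex.real_smul]
  rw [e]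
  exact (norm_add_le _ _).trans (add_le_add (hK x) (integral_stepChar_mul_le hz hz1 hp
    (continuous_meanDeviation hW l) (periodic_meanDeviation hW hper hl) hε hM x))

end step

/-! ### Roots of unity -/

theorem isPrimitiveRoot_conj_omega {b : ℕ} (hb : b ≠ 0) :
    IsPrimitiveRoot (starRingEnd ℂ (omega b)) b :=
  (Complex.isPrimitiveRoot_exp b hb).map_of_injective (starRingEnd ℂ).injective

theorem exists_mem_Ico_of_pow_eq_one {b : ℕ} (hb : b ≠ 0) {z : ℂ} (hz : z ^ b = 1) (hz1 : z ≠ 1) :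
    ∃ c ∈ Ico 1 b, ‖1 - starRingEnd ℂ (omega b) ^ c‖ = ‖1 - z‖ := by
  have := NeZero.mk hb
  obtain ⟨c, hc, rfl⟩ := (isPrimitiveRoot_conj_omega hb).eq_pow_of_pow_eq_one hz
  refine ⟨c, ⟨Nat.one_le_iff_ne_zero.2 ?_, hc⟩, rfl⟩
  rintro rfl
  simp at hz1

theorem mConst_le {b : ℕ} (hb : b ≠ 0) {z : ℂ} (hz : z ^ b = 1) (hz1 : z ≠ 1) :
    mConst b ≤ ‖1 - z‖ :=
  csInf_le ((finite_Ico 1 b).image _).bddBelow (exists_mem_Ico_of_pow_eq_one hb hz hz1)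

theorem le_MConst {b : ℕ} (hb : b ≠ 0) {z : ℂ} (hz : z ^ b = 1) (hz1 : z ≠ 1) :
    ‖1 - z‖ ≤ MConst b :=
  le_csSup ((finite_Ico 1 b).image _).bddAbove (exists_mem_Ico_of_pow_eq_one hb hz hz1)

theorem MConst_nonneg (b : ℕ) : 0 ≤ MConst b :=
  Real.sSup_nonneg (by rintro _ ⟨c, -, rfl⟩; exact norm_nonneg _)

theorem norm_one_sub_zpow_le_MConst {b : ℕ} (hb : b ≠ 0) {z : ℂ} (hz : z ^ b = 1) (c : ℤ) :
    ‖1 - z ^ c‖ ≤ MConst b := by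
  by_cases h : z ^ c = 1
  · rw [h, sub_self, norm_zero]
    exact MConst_nonneg b
  · refine le_MConst hb ?_ h
    rw [← zpow_natCast, ← zpow_mul, mul_comm, zpow_mul, zpow_natCast, hz, one_zpow]

theorem mConst_pos {b : ℕ} (hb : 2 ≤ b) : 0 < mConst b := by
  have : (2 : ℝ) ≤ b := by exact_mod_cast hb
  rw [mConst_eq hb]
  have := Real.sin_pos_of_pos_of_lt_pi (x := Real.pi / b) (by positivity)
    (div_lt_self Real.pi_pos (by linarith))
  linarith

theorem MConst_le_two (b : ℕ) : MConst b ≤ 2 := by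
  refine Real.sSup_le ?_ zero_le_two
  rintro _ ⟨c, hc, rfl⟩
  beta_reduce
  rw [norm_one_sub_omega_pow hc]
  linarith [Real.cos_le_one |Real.pi / 2 - Real.pi * c / b|]

theorem mConst_three : mConst 3 = √3 := by
  rw [mConst_eq (by norm_num), Nat.cast_ofNat, Real.sin_pi_div_three]
  ring

theorem MConst_three : MConst 3 = √3 := by
  rw [MConst_eq (by norm_num), if_neg (by decide), Nat.cast_ofNat,
    show ((3 : ℝ) + 1) * Real.pi / (2 * 3) = Real.pi - Real.pi / 3 by ring, Real.sin_pi_sub,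
    Real.sin_pi_div_three]
  ring

theorem sub_MConst_pos {b : ℕ} (hb : 3 ≤ b) : 0 < b - MConst b := by
  have : (3 : ℝ) ≤ b := by exact_mod_cast hb
  linarith [MConst_le_two b]

/-- The deviation ratio `b / (b - M_b)`. -/
def deviationConst (b : ℕ) : ℝ := b / (b - MConst b)

theorem deviationConst_pos {b : ℕ} (hb : 3 ≤ b) : 0 < deviationConst b :=
  div_pos (by exact_mod_cast (by omega : 0 < b)) (sub_MConst_pos hb)

theorem deviationConst_mul {b : ℕ} (hb : 3 ≤ b) : deviationConst b * (b - MConst b) = b :=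
  div_mul_cancel₀ _ (sub_MConst_pos hb).ne'

/-- The right side is what remains of `b * deviationConst b` after the contribution of the previous
deviation. Half a period suffices for `b ≥ 4`, but not for `b = 3`, since `M_3 = √3 > 3 / 2`. -/
theorem norm_integral_linearPart_le_const {b : ℕ} (hb : 3 ≤ b) {z : ℂ} (hzb : z ^ b = 1)
    (hz1 : z ≠ 1) {p : ℝ} (hp : 0 < p) {W : ℝ → ℂ} {l : ℂ} (hW : Continuous W)
    (hper : Function.Periodic W p) (hl : ∫ t in 0..p, W t = p * l) (x : ℝ) :
    ‖∫ t in 0..x, linearPart z p W l t‖ ≤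
      p * ‖p * l / (1 - z)‖ * (deviationConst b * (b - MConst b - ‖1 - z‖ / 2)) := by
  have hb0 : b ≠ 0 := by omega
  have hz : ‖z‖ = 1 := Complex.norm_eq_one_of_pow_eq_one hzb hb0
  have hd := sub_MConst_pos hb
  have hM2 := MConst_le_two b
  have hzM := le_MConst hb0 hzb hz1
  have hzm := mConst_le hb0 hzb hz1
  rcases hb.eq_or_lt with rfl | h4
  · refine (norm_integral_linearPart_le hz hz1 hp hW hper hl
      (norm_one_sub_zpow_le_MConst hb0 hzb) x).trans ?_
    gcongr
    rw [MConst_three] at hzM hd ⊢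
    rw [mConst_three] at hzm
    have hz3 : ‖1 - z‖ = √3 := le_antisymm hzM hzm
    have h1z : ‖1 + z‖ = 1 := by
      have : 1 + z = - z ^ 2 := by
        have h0 : (1 - z) * (1 + z + z ^ 2) = 0 := by linear_combination -hzb
        have := (mul_eq_zero.1 h0).resolve_left (sub_ne_zero.2 hz1.symm)
        linear_combination this
      rw [this, norm_neg, norm_pow, hz, one_pow]
    have s0 : √3 ≠ 0 := by positivity
    have s2 : √3 ^ 2 = 3 := Real.sq_sqrt (by norm_num)
    have s1 : √3 ≤ 9 / 5 := Real.sqrt_le_iff.2 ⟨by norm_num, by norm_num⟩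
    rw [hz3, h1z, div_self s0, deviationConst, MConst_three]
    push_cast at hd ⊢
    rw [div_mul_eq_mul_div (3 : ℝ), le_div_iff₀ hd]
    nlinarith
  · have h4' : (4 : ℝ) ≤ b := by exact_mod_cast h4
    refine (norm_integral_linearPart_le_half hz hz1 hb0 hzb hp hW hper hl x).trans ?_
    -- Here `‖1 - z‖ ≤ M_b ≤ 2 ≤ b / 2` gives `‖1 - z‖ ≤ b - M_b`, so the subtracted term is at most
    -- half of `deviationConst b * (b - M_b) = b`.
    have : (b : ℝ) / 2 ≤ deviationConst b * (b - MConst b - ‖1 - z‖ / 2) := by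
      have e := deviationConst_mul hb
      have := deviationConst_pos hb
      nlinarith
    calc _ = p * ‖p * l / (1 - z)‖ * (b / 2) := by ring
      _ ≤ _ := by gcongr

/-! ### Iterated primitives of Walsh functions -/

/-- The iterated primitive attached to an increasing list of digit positions. -/
def walshPrimitive (b : ℕ) (z : ℕ → ℂ) : List ℕ → ℝ → ℂ
  | [] => fun _ => 1
  | a :: L => charPrimitive (z a) ((b : ℝ) ^ a)⁻¹ (walshPrimitive b z L)

/-- The mean value of `walshPrimitive b z L`. -/
def walshMean (b : ℕ) (z : ℕ → ℂ) : List ℕ → ℂ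
  | [] => 1
  | a :: L => (((b : ℝ) ^ a)⁻¹ : ℝ) * walshMean b z L / (1 - z a)

section walshPrimitive

variable {b : ℕ} {z : ℕ → ℂ}

/-- The natural period comes from the smallest position `c` of the list and is `b * b ^ (-c)`; it
divides `b ^ (-a)` for every `a < c`, so the next coarser character sees a periodic weight. -/
theorem walshPrimitive_spec (hb : b ≠ 0) (L : List ℕ)
    (hz : ∀ a ∈ L, z a ^ b = 1 ∧ z a ≠ 1) {a : ℕ} (hL : (a :: L).Pairwise (· < ·)) :
    Continuous (walshPrimitive b z L) ∧
    Function.Periodic (walshPrimitive b z L) ((b : ℝ) ^ a)⁻¹ ∧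
    ∫ t in 0..((b : ℝ) ^ a)⁻¹, walshPrimitive b z L t
      = (((b : ℝ) ^ a)⁻¹ : ℝ) * walshMean b z L := by
  have hb0 : (0 : ℝ) < b := by exact_mod_cast Nat.pos_of_ne_zero hb
  induction L generalizing a with
  | nil => exact ⟨continuous_const, fun x => rfl, by simp [walshPrimitive, walshMean]⟩
  | cons c L ih =>
    obtain ⟨hc, hL⟩ := List.pairwise_cons.1 hL
    obtain ⟨ihc, ihp, ihi⟩ := ih (fun a ha => hz a (List.mem_cons_of_mem _ ha)) hL
    obtain ⟨hzb, hz1⟩ := hz c List.mem_cons_self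
    have hzn : ‖z c‖ = 1 := Complex.norm_eq_one_of_pow_eq_one hzb hb
    have hp : 0 < ((b : ℝ) ^ c)⁻¹ := by positivity
    obtain ⟨n, hn⟩ := Nat.exists_eq_add_of_lt (hc c List.mem_cons_self)
    have e : ((b : ℝ) ^ a)⁻¹ = ((b ^ n : ℕ) : ℝ) * (b * ((b : ℝ) ^ c)⁻¹) := by
      rw [hn]
      push_cast
      field_simp
      ring
    have h1 : Continuous (walshPrimitive b z (c :: L)) := continuous_charPrimitive hzn ihc
    have h2 : Function.Periodic (walshPrimitive b z (c :: L)) (b * ((b : ℝ) ^ c)⁻¹) :=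
      periodic_charPrimitive hzn hz1 hzb hp ihc ihp
    refine ⟨h1, ?_, ?_⟩
    · rw [e]
      exact h2.nat_mul _
    · have := (periodic_meanDeviation h1 h2
        (integral_charPrimitive_period hzn hz1 hzb hp ihc ihp ihi)).nat_mul (b ^ n) 0
      rw [zero_add, meanDeviation_zero, ← e, meanDeviation, sub_eq_zero] at this
      exact this

theorem continuous_walshPrimitive (hb : b ≠ 0) (L : List ℕ)
    (hz : ∀ a ∈ L, z a ^ b = 1 ∧ z a ≠ 1) (hL : L.Pairwise (· < ·)) :
    Continuous (walshPrimitive b z L) := by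
  cases L with
  | nil => exact continuous_const
  | cons c L =>
    obtain ⟨hzb, hz1⟩ := hz c List.mem_cons_self
    exact continuous_charPrimitive (Complex.norm_eq_one_of_pow_eq_one hzb hb)
      (walshPrimitive_spec hb L (fun a ha => hz a (List.mem_cons_of_mem _ ha)) hL).1

theorem norm_walshMean_le (hb : 2 ≤ b) (L : List ℕ) (hz : ∀ a ∈ L, z a ^ b = 1 ∧ z a ≠ 1) :
    ‖walshMean b z L‖ ≤ ((b : ℝ) ^ L.sum)⁻¹ * (mConst b)⁻¹ ^ L.length := by
  have hm := mConst_pos hb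
  induction L with
  | nil => simp [walshMean]
  | cons c L ih =>
    obtain ⟨hzb, hz1⟩ := hz c List.mem_cons_self
    have ih := ih fun a ha => hz a (List.mem_cons_of_mem _ ha)
    have := mConst_le (by omega) hzb hz1
    rw [walshMean, norm_div, norm_mul, Complex.norm_real, Real.norm_of_nonneg (by positivity)]
    calc _ ≤ ((b : ℝ) ^ c)⁻¹ * (((b : ℝ) ^ L.sum)⁻¹ * (mConst b)⁻¹ ^ L.length) / mConst b := by
          gcongr
      _ = _ := by
          rw [List.sum_cons, List.length_cons, pow_add, mul_inv, pow_succ]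
          ring

theorem norm_meanDeviation_walshPrimitive_le (hb : 3 ≤ b) (L : List ℕ)
    (hz : ∀ a ∈ L, z a ^ b = 1 ∧ z a ≠ 1) {a : ℕ} (hL : (a :: L).Pairwise (· < ·)) (x : ℝ) :
    ‖meanDeviation (walshPrimitive b z L) (walshMean b z L) x‖ ≤
      ‖walshMean b z L‖ * ((b : ℝ) ^ a)⁻¹ * deviationConst b := by
  have hb0 : b ≠ 0 := by omega
  have hbpos : (0 : ℝ) < b := by exact_mod_cast Nat.pos_of_ne_zero hb0
  have hB := deviationConst_pos hb
  induction L generalizing a x with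
  | nil =>
    have : meanDeviation (walshPrimitive b z []) (walshMean b z []) x = 0 := by
      simp [meanDeviation, walshPrimitive, walshMean]
    rw [this, norm_zero]
    positivity
  | cons c L ih =>
    obtain ⟨hc, hL⟩ := List.pairwise_cons.1 hL
    have hz' : ∀ a ∈ L, z a ^ b = 1 ∧ z a ≠ 1 := fun a ha => hz a (List.mem_cons_of_mem _ ha)
    obtain ⟨ihc, ihp, ihi⟩ := walshPrimitive_spec hb0 L hz' hL
    obtain ⟨hzb, hz1⟩ := hz c List.mem_cons_self
    have hzn : ‖z c‖ = 1 := Complex.norm_eq_one_of_pow_eq_one hzb hb0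
    have hp : 0 < ((b : ℝ) ^ c)⁻¹ := by positivity
    have hz0 : ‖1 - z c‖ ≠ 0 := norm_ne_zero_iff.2 (sub_ne_zero.2 hz1.symm)
    refine (norm_meanDeviation_charPrimitive_le hzn hz1 hp ihc ihp ihi
      (norm_one_sub_zpow_le_MConst hb0 hzb) (ih hz' hL)
      (norm_integral_linearPart_le_const hb hzb hz1 hp ihc ihp ihi) x).trans ?_
    have hpp : b * ((b : ℝ) ^ c)⁻¹ ≤ ((b : ℝ) ^ a)⁻¹ := by
      rw [← div_eq_mul_inv, div_le_iff₀ (by positivity), ← div_eq_inv_mul,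
        le_div_iff₀ (by positivity), ← pow_succ']
      exact pow_le_pow_right₀ (by exact_mod_cast Nat.one_le_iff_ne_zero.2 hb0)
        (hc c List.mem_cons_self)
    -- The induction closes exactly: `(b - M_b - ‖1 - z c‖ / 2) + (M_b + ‖1 - z c‖ / 2) = b`.
    calc _ = ‖walshMean b z (c :: L)‖ * (b * ((b : ℝ) ^ c)⁻¹) * deviationConst b := by
          rw [walshMean, norm_div, norm_mul, Complex.norm_real, Real.norm_of_nonneg hp.le]
          field_simp
          ring
      _ ≤ _ := by gcongr

/-- The primitive alternately climbs from `0` to the integral of `w` over a cell and descends back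
to `0`. -/
theorem charPrimitive_neg_one_mem {p : ℝ} (hp : 0 < p) {w : ℝ → ℝ} (hw : Continuous w)
    (h0 : ∀ x, 0 ≤ w x) (hper : Function.Periodic w p) (x : ℝ) :
    ∃ r ∈ Icc 0 (∫ t in 0..p, w t), charPrimitive (-1) p (fun t => (w t : ℂ)) x = r := by
  obtain ⟨c, u, hu, rfl⟩ := exists_floor_decomp hp x
  have hu' : u ∈ Icc 0 p := ⟨hu.1, hu.2.le⟩
  have e := affine_translate_eq (by norm_num) (by norm_num) (charPrimitive_add (z := -1) (by simp)
    hp (Complex.continuous_ofReal.comp hw) (hper.comp _)) c u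
  simp only [Function.comp_def] at e
  have i1 : 0 ≤ ∫ t in 0..u, w t := integral_nonneg hu.1 fun t _ => h0 t
  have i2 : ∫ t in 0..u, w t ≤ ∫ t in 0..p, w t := by
    rw [← integral_add_adjacent_intervals (hw.intervalIntegrable 0 u) (hw.intervalIntegrable u p)]
    exact le_add_of_nonneg_right (integral_nonneg hu.2.le fun t _ => h0 t)
  rw [charPrimitive_of_mem_Icc hu', intervalIntegral.integral_ofReal,
    intervalIntegral.integral_ofReal] at e
  rw [e]
  rcases Int.even_or_odd c with h | h
  · refine ⟨∫ t in 0..u, w t, ⟨i1, i2⟩, ?_⟩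
    rw [h.neg_one_zpow]
    ring
  · refine ⟨(∫ t in 0..p, w t) - ∫ t in 0..u, w t, ⟨by linarith, by linarith⟩, ?_⟩
    rw [h.neg_one_zpow]
    push_cast
    ring

theorem walshPrimitive_two_nonneg (L : List ℕ) (hz : ∀ a ∈ L, z a ^ 2 = 1 ∧ z a ≠ 1)
    (hL : L.Pairwise (· < ·)) :
    ∃ w : ℝ → ℝ, (∀ x, 0 ≤ w x) ∧ walshPrimitive 2 z L = fun x => (w x : ℂ) := by
  induction L with
  | nil => exact ⟨fun _ => 1, fun _ => zero_le_one, by simp [walshPrimitive]⟩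
  | cons c L ih =>
    have hz' : ∀ a ∈ L, z a ^ 2 = 1 ∧ z a ≠ 1 := fun a ha => hz a (List.mem_cons_of_mem _ ha)
    obtain ⟨w, hw0, hw⟩ := ih hz' hL.of_cons
    obtain ⟨ihc, ihp, -⟩ := walshPrimitive_spec two_ne_zero L hz' hL
    rw [hw] at ihc ihp
    have hzc : z c = -1 := (sq_eq_one_iff.1 (hz c List.mem_cons_self).1).resolve_left
      (hz c List.mem_cons_self).2
    have hwc : Continuous w := Complex.continuous_re.comp ihc
    have hwp : Function.Periodic w (((2 : ℕ) : ℝ) ^ c)⁻¹ := fun x => Complex.ofReal_injective (ihp x)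
    choose r hr1 hr2 using charPrimitive_neg_one_mem (p := (((2 : ℕ) : ℝ) ^ c)⁻¹) (by positivity)
      hwc hw0 hwp
    refine ⟨r, fun x => (hr1 x).1, ?_⟩
    funext x
    rw [walshPrimitive, hw, hzc, hr2]

theorem norm_walshPrimitive_two_le (L : List ℕ) {c : ℕ} (hz : ∀ a ∈ c :: L, z a ^ 2 = 1 ∧ z a ≠ 1)
    (hL : (c :: L).Pairwise (· < ·)) (x : ℝ) :
    ‖walshPrimitive 2 z (c :: L) x‖ ≤ (((2 : ℕ) : ℝ) ^ c)⁻¹ * ‖walshMean 2 z L‖ := by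
  have hz' : ∀ a ∈ L, z a ^ 2 = 1 ∧ z a ≠ 1 := fun a ha => hz a (List.mem_cons_of_mem _ ha)
  obtain ⟨w, hw0, hw⟩ := walshPrimitive_two_nonneg L hz' hL.of_cons
  obtain ⟨ihc, ihp, ihi⟩ := walshPrimitive_spec two_ne_zero L hz' hL
  rw [hw] at ihc ihp ihi
  have hp : 0 < (((2 : ℕ) : ℝ) ^ c)⁻¹ := by positivity
  have hzc : z c = -1 := (sq_eq_one_iff.1 (hz c List.mem_cons_self).1).resolve_left
    (hz c List.mem_cons_self).2
  have hwc : Continuous w := Complex.continuous_re.comp ihc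
  have hwp : Function.Periodic w (((2 : ℕ) : ℝ) ^ c)⁻¹ := fun x => Complex.ofReal_injective (ihp x)
  obtain ⟨r, hr1, hr2⟩ := charPrimitive_neg_one_mem hp hwc hw0 hwp x
  rw [walshPrimitive, hw, hzc, hr2, Complex.norm_real, Real.norm_of_nonneg hr1.1]
  refine hr1.2.trans (le_of_eq ?_)
  rw [intervalIntegral.integral_ofReal] at ihi
  have := congrArg norm ihi
  rwa [norm_mul, Complex.norm_real, Complex.norm_real, Real.norm_of_nonneg hp.le,
    Real.norm_of_nonneg (hr1.1.trans hr1.2)] at this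

/-- The sup norm bound for iterated primitives of Walsh functions. -/
theorem norm_walshPrimitive_le (hb : 2 ≤ b) (L : List ℕ)
    (hz : ∀ a ∈ L, z a ^ b = 1 ∧ z a ≠ 1) (hL : L.Pairwise (· < ·)) (x : ℝ) :
    ‖walshPrimitive b z L x‖ ≤
      ((b : ℝ) ^ L.sum)⁻¹ * ((mConst b)⁻¹ ^ L.length * CConst b ^ min 1 L.length) := by
  have hb0 : b ≠ 0 := by omega
  have hm := mConst_pos hb
  cases L with
  | nil => simp [walshPrimitive]
  | cons c L =>
    have hz' : ∀ a ∈ L, z a ^ b = 1 ∧ z a ≠ 1 := fun a ha => hz a (List.mem_cons_of_mem _ ha)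
    have hp : 0 < ((b : ℝ) ^ c)⁻¹ := by positivity
    have hmean := norm_walshMean_le hb L hz'
    -- Only the coarsest position pays `C_b`; the others enter through the mean.
    suffices h : ‖walshPrimitive b z (c :: L) x‖ ≤
        ((b : ℝ) ^ c)⁻¹ * ‖walshMean b z L‖ * (CConst b / mConst b) by
      have hC : 0 ≤ CConst b := by
        rcases hb.eq_or_lt with rfl | h3
        · simp [CConst]
        · rw [CConst, if_neg (by omega)]
          have := sub_MConst_pos h3
          have := MConst_nonneg b
          positivity
      calc _ ≤ _ := h
        _ ≤ ((b : ℝ) ^ c)⁻¹ * (((b : ℝ) ^ L.sum)⁻¹ * (mConst b)⁻¹ ^ L.length)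
            * (CConst b / mConst b) := by gcongr
        _ = _ := by
            rw [List.sum_cons, List.length_cons, min_eq_left (by omega), pow_add, mul_inv,
              pow_succ, pow_one]
            ring
    rcases hb.eq_or_lt with rfl | h3
    · have : mConst 2 = 2 := by
        rw [mConst_eq le_rfl]
        simp
      rw [this, CConst, if_pos rfl, div_self two_ne_zero, mul_one]
      exact norm_walshPrimitive_two_le L hz hL x
    · obtain ⟨ihc, ihp, ihi⟩ := walshPrimitive_spec hb0 L hz' hL
      obtain ⟨hzb, hz1⟩ := hz c List.mem_cons_self
      have hzn : ‖z c‖ = 1 := Complex.norm_eq_one_of_pow_eq_one hzb hb0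
      have hzm := mConst_le hb0 hzb hz1
      have hM0 := MConst_nonneg b
      refine (norm_charPrimitive_le hzn hz1 hp ihc ihp ihi
        (norm_one_sub_zpow_le_MConst hb0 hzb)
        (norm_meanDeviation_walshPrimitive_le h3 L hz' hL) x).trans ?_
      rw [norm_div, norm_mul, Complex.norm_real, Real.norm_of_nonneg hp.le, CConst,
        if_neg (by omega), deviationConst]
      -- The identity `M_b / m_b + b / (b - M_b) = C_b / m_b` is the origin of `C_b`.
      calc _ ≤ ((b : ℝ) ^ c)⁻¹ * ‖walshMean b z L‖ / mConst b * MConst b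
            + ‖walshMean b z L‖ * ((b : ℝ) ^ c)⁻¹ * (b / (b - MConst b)) := by gcongr
        _ = _ := by
          have := (sub_MConst_pos h3).ne'
          field_simp

end walshPrimitive

/-! ### Integration by parts in one variable -/

/-- The product of the step characters attached to a list of digit positions. -/
def charProd (b : ℕ) (z : ℕ → ℂ) (L : List ℕ) (x : ℝ) : ℂ :=
  (L.map fun a => stepChar (z a) ((b : ℝ) ^ a)⁻¹ x).prod

/-- The derivative on the closed unit interval. -/
def derivUnit (g : ℝ → ℂ) : ℝ → ℂ := derivWithin g (Icc 0 1)

theorem contDiffOn_derivUnit {g : ℝ → ℂ} (hg : ContDiffOn ℝ ∞ g (Icc 0 1)) :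
    ContDiffOn ℝ ∞ (derivUnit g) (Icc 0 1) :=
  hg.derivWithin (uniqueDiffOn_Icc zero_lt_one) le_rfl

section charProd

variable {b : ℕ} {z : ℕ → ℂ}

theorem charProd_append (L₁ L₂ : List ℕ) (x : ℝ) :
    charProd b z (L₁ ++ L₂) x = charProd b z L₁ x * charProd b z L₂ x := by
  simp [charProd]

theorem charProd_singleton (a : ℕ) (x : ℝ) :
    charProd b z [a] x = stepChar (z a) ((b : ℝ) ^ a)⁻¹ x := by
  simp [charProd]

theorem charProd_cons (a : ℕ) (L : List ℕ) (x : ℝ) :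
    charProd b z (a :: L) x = stepChar (z a) ((b : ℝ) ^ a)⁻¹ x * charProd b z L x := by
  simp [charProd]

theorem measurable_charProd (L : List ℕ) : Measurable (charProd b z L) := by
  induction L with
  | nil => exact measurable_const
  | cons a L ih =>
    rw [show charProd b z (a :: L) = fun x => _ from funext (charProd_cons a L)]
    exact (measurable_stepChar _ _).mul ih

theorem norm_charProd {L : List ℕ} (hz : ∀ a ∈ L, ‖z a‖ = 1) (x : ℝ) :
    ‖charProd b z L x‖ = 1 := by
  induction L with
  | nil => simp [charProd]
  | cons a L ih =>
    rw [charProd_cons, norm_mul, norm_stepChar (hz a List.mem_cons_self),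
      ih fun a ha => hz a (List.mem_cons_of_mem _ ha), one_mul]

theorem charProd_eventuallyEq {L : List ℕ} {x : ℝ}
    (hx : ∀ a ∈ L, ∀ n : ℤ, x / ((b : ℝ) ^ a)⁻¹ ≠ n) :
    ∀ᶠ y in nhds x, charProd b z L y = charProd b z L x := by
  induction L with
  | nil => exact Filter.Eventually.of_forall fun y => rfl
  | cons a L ih =>
    filter_upwards [ih fun a ha => hx a (List.mem_cons_of_mem _ ha),
      stepChar_eventuallyEq (z := z a) (hx a List.mem_cons_self)] with y h1 h2
    rw [charProd_cons, charProd_cons, h1, h2]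

theorem walshPrimitive_int_mul (hb : b ≠ 0) {a : ℕ} {L : List ℕ}
    (hz : ∀ c ∈ a :: L, z c ^ b = 1 ∧ z c ≠ 1) (hL : (a :: L).Pairwise (· < ·)) (n : ℤ) :
    walshPrimitive b z (a :: L) (n * (b * ((b : ℝ) ^ a)⁻¹)) = 0 := by
  have hb0 : (0 : ℝ) < b := by exact_mod_cast Nat.pos_of_ne_zero hb
  obtain ⟨hzb, hz1⟩ := hz a List.mem_cons_self
  obtain ⟨h1, h2, -⟩ := walshPrimitive_spec hb L (fun a ha => hz a (List.mem_cons_of_mem _ ha)) hL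
  exact charPrimitive_int_mul (Complex.norm_eq_one_of_pow_eq_one hzb hb) hz1 hzb (by positivity)
    h1 h2 n

/-- For `c < a`, a multiple of `b ^ (-c)` is a multiple of `b * b ^ (-a)`. -/
theorem walshPrimitive_eq_zero_of_jump (hb : b ≠ 0) {a : ℕ} {L : List ℕ}
    (hz : ∀ c ∈ a :: L, z c ^ b = 1 ∧ z c ≠ 1) (hL : (a :: L).Pairwise (· < ·)) {c : ℕ}
    (hc : c < a) {n : ℤ} {x : ℝ} (hx : x / ((b : ℝ) ^ c)⁻¹ = n) :
    walshPrimitive b z (a :: L) x = 0 := by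
  have hb0 : (b : ℝ) ≠ 0 := by exact_mod_cast hb
  obtain ⟨d, rfl⟩ := Nat.exists_eq_add_of_lt hc
  have : x = ((n * b ^ d : ℤ) : ℝ) * (b * ((b : ℝ) ^ (c + d + 1))⁻¹) := by
    rw [div_eq_iff (by positivity)] at hx
    rw [hx]
    push_cast
    field_simp
    ring
  rw [this]
  exact walshPrimitive_int_mul hb hz hL _

/-- At each jump of the bounded character product the continuous second factor vanishes. -/
theorem continuous_charProd_mul_walshPrimitive (hb : b ≠ 0) {a : ℕ} {L₁ L₂ : List ℕ}
    (hz : ∀ c ∈ L₁ ++ a :: L₂, z c ^ b = 1 ∧ z c ≠ 1) (hL : (L₁ ++ a :: L₂).Pairwise (· < ·)) :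
    Continuous fun x => charProd b z L₁ x * walshPrimitive b z (a :: L₂) x := by
  obtain ⟨-, hL2, hlt⟩ := List.pairwise_append.1 hL
  have hz2 : ∀ c ∈ a :: L₂, z c ^ b = 1 ∧ z c ≠ 1 := fun c hc => hz c (List.mem_append_right _ hc)
  have hW := continuous_walshPrimitive hb (a :: L₂) hz2 hL2
  have hn : ∀ c ∈ L₁, ‖z c‖ = 1 := fun c hc =>
    Complex.norm_eq_one_of_pow_eq_one (hz c (List.mem_append_left _ hc)).1 hb
  refine continuous_iff_continuousAt.2 fun x => ?_
  by_cases hx : ∀ c ∈ L₁, ∀ n : ℤ, x / ((b : ℝ) ^ c)⁻¹ ≠ n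
  · have h1 : ContinuousAt (charProd b z L₁) x := by
      refine ContinuousAt.congr (f := fun _ => charProd b z L₁ x) continuousAt_const ?_
      filter_upwards [charProd_eventuallyEq (z := z) hx] with y hy using hy.symm
    exact h1.mul hW.continuousAt
  · push Not at hx
    obtain ⟨c, hc, n, hn'⟩ := hx
    have h0 := walshPrimitive_eq_zero_of_jump hb hz2 hL2 (hlt c hc a List.mem_cons_self) hn'
    have ht := hW.tendsto x
    rw [h0] at ht
    rw [ContinuousAt, h0, mul_zero]
    refine squeeze_zero_norm (fun y => ?_) (tendsto_zero_iff_norm_tendsto_zero.1 ht)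
    rw [norm_mul, norm_charProd hn, one_mul]

theorem intervalIntegrable_mul_bdd {g χ : ℝ → ℂ} (hg : ContinuousOn g (Icc 0 1))
    (hχ : Measurable χ) {B : ℝ} (hB : ∀ x, ‖χ x‖ ≤ B) :
    IntervalIntegrable (fun x => g x * χ x) volume 0 1 := by
  have := hg.intervalIntegrable_of_Icc (μ := volume) zero_le_one
  rw [intervalIntegrable_iff_integrableOn_Ioc_of_le zero_le_one] at this ⊢
  exact Integrable.mul_bdd (c := B) this hχ.aestronglyMeasurable (Filter.Eventually.of_forall hB)

/-- The finest remaining character, at position `a`, is absorbed into the primitive. The product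
rule holds off the countable set of multiples of `b ^ (-a)`, which contains the jumps of the coarser
characters; continuity suffices on that set. -/
theorem integral_mul_charProd_step (hb : b ≠ 0) {g : ℝ → ℂ} (hg : ContDiffOn ℝ ∞ g (Icc 0 1))
    {a : ℕ} (ha : 1 ≤ a) {L₁ L₂ : List ℕ}
    (hz : ∀ c ∈ L₁ ++ a :: L₂, z c ^ b = 1 ∧ z c ≠ 1) (hL : (L₁ ++ a :: L₂).Pairwise (· < ·)) :
    ∫ x in (0 : ℝ)..1, g x * (charProd b z (L₁ ++ [a]) x * walshPrimitive b z L₂ x)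
      = -∫ x in (0 : ℝ)..1, derivUnit g x *
        (charProd b z L₁ x * walshPrimitive b z (a :: L₂) x) := by
  have hb0 : (b : ℝ) ≠ 0 := by exact_mod_cast hb
  obtain ⟨-, hL2, hlt⟩ := List.pairwise_append.1 hL
  have hz2 : ∀ c ∈ a :: L₂, z c ^ b = 1 ∧ z c ≠ 1 := fun c hc => hz c (List.mem_append_right _ hc)
  have hz3 : ∀ c ∈ L₂, z c ^ b = 1 ∧ z c ≠ 1 := fun c hc => hz2 c (List.mem_cons_of_mem _ hc)
  have hn : ∀ c ∈ L₁ ++ [a], ‖z c‖ = 1 := fun c hc =>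
    Complex.norm_eq_one_of_pow_eq_one (hz c (by
      rcases List.mem_append.1 hc with h | h <;> simp_all)).1 hb
  have hW := walshPrimitive_spec hb L₂ hz3 hL2
  have hG := continuous_charProd_mul_walshPrimitive hb hz hL
  have hg' := contDiffOn_derivUnit hg
  have i1 : IntervalIntegrable (fun x => derivUnit g x *
      (charProd b z L₁ x * walshPrimitive b z (a :: L₂) x)) volume 0 1 :=
    (hg'.continuousOn.mul hG.continuousOn).intervalIntegrable_of_Icc zero_le_one
  have i2 : IntervalIntegrable (fun x => g x *
      (charProd b z (L₁ ++ [a]) x * walshPrimitive b z L₂ x)) volume 0 1 := by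
    have := intervalIntegrable_mul_bdd (hg.continuousOn.mul hW.1.continuousOn)
      (measurable_charProd (b := b) (z := z) (L₁ ++ [a])) (fun x => (norm_charProd hn x).le)
    refine this.congr fun x _ => ?_
    rw [Pi.mul_apply]
    ring
  have hs : (range fun n : ℤ => (n : ℝ) * ((b : ℝ) ^ a)⁻¹).Countable := countable_range _
  have key := integral_eq_of_hasDerivAt_off_countable_of_le
    (fun x => g x * (charProd b z L₁ x * walshPrimitive b z (a :: L₂) x)) _ zero_le_one hs
    (hg.continuousOn.mul hG.continuousOn) ?_ (i1.add i2)
  · have e1 : walshPrimitive b z (a :: L₂) 1 = 0 :=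
      walshPrimitive_eq_zero_of_jump hb hz2 hL2 (c := 0) (n := 1) (by omega) (by simp)
    have e0 : walshPrimitive b z (a :: L₂) 0 = 0 :=
      walshPrimitive_eq_zero_of_jump hb hz2 hL2 (c := 0) (n := 0) (by omega) (by simp)
    rw [intervalIntegral.integral_add i1 i2, e1, e0] at key
    linear_combination key
  · rintro x ⟨hx, hxs⟩
    have hxa : ∀ n : ℤ, x / ((b : ℝ) ^ a)⁻¹ ≠ n := fun n hn =>
      hxs ⟨n, ((div_eq_iff (by positivity)).1 hn).symm⟩
    have hxL : ∀ c ∈ L₁, ∀ n : ℤ, x / ((b : ℝ) ^ c)⁻¹ ≠ n := by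
      intro c hc n hcn
      obtain ⟨d, rfl⟩ := Nat.exists_eq_add_of_lt (hlt c hc a List.mem_cons_self)
      refine hxa (n * b ^ (d + 1)) ?_
      push_cast
      rw [← hcn, div_inv_eq_mul, div_inv_eq_mul]
      ring
    have d1 : HasDerivAt g (derivUnit g x) x :=
      ((hg.differentiableOn (by simp) x ⟨hx.1.le, hx.2.le⟩).hasDerivWithinAt).hasDerivAt
        (Icc_mem_nhds hx.1 hx.2)
    have d2 := hasDerivAt_charPrimitive (z := z a) (hn a (by simp)) hW.1 hxa
    have d3 : HasDerivAt (fun x => charProd b z L₁ x * walshPrimitive b z (a :: L₂) x)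
        (charProd b z L₁ x * (stepChar (z a) ((b : ℝ) ^ a)⁻¹ x * walshPrimitive b z L₂ x)) x := by
      refine (d2.const_mul (charProd b z L₁ x)).congr_of_eventuallyEq ?_
      filter_upwards [charProd_eventuallyEq (z := z) hxL] with y hy
      rw [hy, walshPrimitive]
    refine (d1.mul d3).congr_deriv ?_
    rw [charProd_append, charProd_singleton]
    ring

/-- Repeated integration by parts of a smooth function against a product of step characters. -/
theorem integral_mul_charProd (hb : b ≠ 0) {g : ℝ → ℂ} (hg : ContDiffOn ℝ ∞ g (Icc 0 1))
    {L₁ L₂ : List ℕ} (h1 : ∀ a ∈ L₁, 1 ≤ a)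
    (hz : ∀ c ∈ L₁ ++ L₂, z c ^ b = 1 ∧ z c ≠ 1) (hL : (L₁ ++ L₂).Pairwise (· < ·)) :
    ∫ x in (0 : ℝ)..1, g x * (charProd b z L₁ x * walshPrimitive b z L₂ x)
      = (-1) ^ L₁.length * ∫ x in (0 : ℝ)..1, derivUnit^[L₁.length] g x *
        walshPrimitive b z (L₁ ++ L₂) x := by
  -- Positions increase along the list, so removing from its end treats the finest character first;
  -- `L₂` collects those already absorbed.
  induction L₁ using List.reverseRecOn generalizing L₂ g with
  | nil => simp [charProd]
  | append_singleton L a ih =>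
    rw [List.append_assoc, List.singleton_append] at hz hL ⊢
    rw [integral_mul_charProd_step hb hg (h1 a (by simp)) hz hL,
      ih (contDiffOn_derivUnit hg) (fun c hc => h1 c (by simp [hc])) hz hL, List.length_append,
      List.length_singleton, Function.iterate_succ_apply, pow_succ]
    ring

end charProd

end OneVar

/-! ### Integrals over the unit cube -/

theorem measurableSet_unitCube (s : ℕ) : MeasurableSet (unitCube s) :=
  MeasurableSet.univ_pi fun _ => measurableSet_Ico

theorem unitCube_subset_Icc (s : ℕ) : unitCube s ⊆ Icc 0 1 := fun _ hx =>
  ⟨fun j => (hx j (mem_univ j)).1, fun j => (hx j (mem_univ j)).2.le⟩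

theorem integrableOn_unitCube {s : ℕ} {g χ : (Fin s → ℝ) → ℂ} (hg : ContinuousOn g (Icc 0 1))
    (hχ : Measurable χ) {B : ℝ} (hB : ∀ x, ‖χ x‖ ≤ B) :
    IntegrableOn (fun x => g x * χ x) (unitCube s) :=
  Integrable.mul_bdd (c := B)
    ((hg.integrableOn_compact isCompact_Icc).mono_set (unitCube_subset_Icc s))
    hχ.aestronglyMeasurable (Filter.Eventually.of_forall hB)

theorem integral_unitCube_insertNth {s : ℕ} (j : Fin (s + 1)) {F : (Fin (s + 1) → ℝ) → ℂ}
    (hF : IntegrableOn F (unitCube (s + 1))) :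
    ∫ x in unitCube (s + 1), F x
      = ∫ y in unitCube s, ∫ t in (0 : ℝ)..1, F (j.insertNth (α := fun _ => ℝ) t y) := by
  have hv := (volume_preserving_piFinSuccAbove (fun _ : Fin (s + 1) => ℝ) j).symm
  have he := (MeasurableEquiv.piFinSuccAbove (fun _ : Fin (s + 1) => ℝ) j).symm.measurableEmbedding
  have hpre : (MeasurableEquiv.piFinSuccAbove (fun _ : Fin (s + 1) => ℝ) j).symm ⁻¹'
      unitCube (s + 1) = Ico (0 : ℝ) 1 ×ˢ unitCube s := by
    ext ⟨t, y⟩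
    simp [unitCube, MeasurableEquiv.piFinSuccAbove_symm_apply, Fin.insertNthEquiv,
      j.forall_iff_succAbove]
  have hF' := (hv.restrict_preimage_emb he (unitCube (s + 1))).integrable_comp_emb he |>.2 hF
  rw [← hv.setIntegral_preimage_emb he]
  rw [hpre] at hF' ⊢
  rw [Measure.volume_eq_prod, ← Measure.prod_restrict] at hF' ⊢
  refine (integral_prod_symm _ hF').trans ?_
  refine integral_congr_ae (Filter.Eventually.of_forall fun y => ?_)
  beta_reduce
  rw [intervalIntegral.integral_of_le zero_le_one, ← integral_Ico_eq_integral_Ioc]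
  rfl

theorem integral_unitCube_congr_line {s : ℕ} (j : Fin s) {F G : (Fin s → ℝ) → ℂ}
    (hF : IntegrableOn F (unitCube s)) (hG : IntegrableOn G (unitCube s))
    (h : ∀ x ∈ unitCube s, ∫ t in (0 : ℝ)..1, F (Function.update x j t)
      = ∫ t in (0 : ℝ)..1, G (Function.update x j t)) :
    ∫ x in unitCube s, F x = ∫ x in unitCube s, G x := by
  cases s with
  | zero => exact j.elim0
  | succ s =>
    rw [integral_unitCube_insertNth j hF, integral_unitCube_insertNth j hG]
    refine setIntegral_congr_fun (measurableSet_unitCube s) fun y hy => ?_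
    have hx : j.insertNth (α := fun _ => ℝ) 0 y ∈ unitCube (s + 1) := by
      simp only [unitCube, mem_univ_pi, j.forall_iff_succAbove, Fin.insertNth_apply_same,
        Fin.insertNth_apply_succAbove]
      exact ⟨by simp, fun i => hy i (mem_univ i)⟩
    simpa only [Fin.update_insertNth] using h _ hx

/-! ### Mixed derivatives -/

theorem update_mem_Icc {s : ℕ} (j : Fin s) {x : Fin s → ℝ} (hx : x ∈ Icc (0 : Fin s → ℝ) 1)
    {t : ℝ} (ht : t ∈ Icc (0 : ℝ) 1) : Function.update x j t ∈ Icc (0 : Fin s → ℝ) 1 :=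
  ⟨le_update_iff.2 ⟨ht.1, fun i _ => hx.1 i⟩, update_le_iff.2 ⟨ht.2, fun i _ => hx.2 i⟩⟩

theorem uniqueDiffOn_cube (s : ℕ) : UniqueDiffOn ℝ (Icc (0 : Fin s → ℝ) 1) := by
  rw [← pi_univ_Icc]
  exact UniqueDiffOn.univ_pi fun i => uniqueDiffOn_Icc zero_lt_one

theorem contDiffOn_line {s : ℕ} (j : Fin s) {g : (Fin s → ℝ) → ℂ}
    (hg : ContDiffOn ℝ ∞ g (Icc 0 1)) {x : Fin s → ℝ} (hx : x ∈ Icc (0 : Fin s → ℝ) 1) :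
    ContDiffOn ℝ ∞ (fun t => g (Function.update x j t)) (Icc 0 1) :=
  hg.comp (contDiff_update ∞ x j).contDiffOn fun _ ht => update_mem_Icc j hx ht

/-- On the closed cube the one-sided partial derivative is the Fréchet derivative within the cube,
applied to a basis vector. -/
theorem contDiffOn_partialDeriv {s : ℕ} (j : Fin s) {g : (Fin s → ℝ) → ℂ}
    (hg : ContDiffOn ℝ ∞ g (Icc 0 1)) : ContDiffOn ℝ ∞ (partialDeriv j g) (Icc 0 1) := by
  have h1 : ContDiffOn ℝ ∞ (fun x => fderivWithin ℝ g (Icc 0 1) x (Pi.single j 1)) (Icc 0 1) :=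
    (hg.fderivWithin (uniqueDiffOn_cube s) le_rfl).clm_apply contDiffOn_const
  refine h1.congr fun x hx => ?_
  have hd : HasFDerivWithinAt g (fderivWithin ℝ g (Icc 0 1) x) (Icc 0 1) x :=
    (hg.differentiableOn (by simp) x hx).hasFDerivWithinAt
  have hxj : x j ∈ Icc (0 : ℝ) 1 := ⟨hx.1 j, hx.2 j⟩
  exact (hd.comp_hasDerivWithinAt_of_eq (x j) (hasDerivAt_update x j (x j)).hasDerivWithinAt
    (fun t ht => update_mem_Icc j hx ht) (Function.update_eq_self j x).symm).derivWithin
    (uniqueDiffOn_Icc zero_lt_one _ hxj)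

theorem contDiffOn_partialDeriv_iterate {s : ℕ} (j : Fin s) (n : ℕ) {g : (Fin s → ℝ) → ℂ}
    (hg : ContDiffOn ℝ ∞ g (Icc 0 1)) : ContDiffOn ℝ ∞ ((partialDeriv j)^[n] g) (Icc 0 1) := by
  induction n with
  | zero => exact hg
  | succ n ih =>
    rw [Function.iterate_succ_apply']
    exact contDiffOn_partialDeriv j ih

theorem partialDeriv_iterate_update {s : ℕ} (j : Fin s) (n : ℕ) (g : (Fin s → ℝ) → ℂ)
    (x : Fin s → ℝ) (t : ℝ) :
    (partialDeriv j)^[n] g (Function.update x j t)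
      = derivUnit^[n] (fun t => g (Function.update x j t)) t := by
  induction n generalizing t with
  | zero => rfl
  | succ n ih =>
    rw [Function.iterate_succ_apply', Function.iterate_succ_apply', partialDeriv, derivUnit,
      Function.update_self]
    simp_rw [Function.update_idem, ih]

/-- The mixed derivative restricted to the coordinates in a list. -/
def listDeriv {s : ℕ} (n : Fin s → ℕ) (l : List (Fin s)) (f : (Fin s → ℝ) → ℂ) :
    (Fin s → ℝ) → ℂ :=
  l.foldr (fun j g => (partialDeriv j)^[n j] g) f

theorem contDiffOn_listDeriv {s : ℕ} (n : Fin s → ℕ) (l : List (Fin s)) {f : (Fin s → ℝ) → ℂ}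
    (hf : ContDiffOn ℝ ∞ f (Icc 0 1)) : ContDiffOn ℝ ∞ (listDeriv n l f) (Icc 0 1) := by
  induction l with
  | nil => exact hf
  | cons j l ih => exact contDiffOn_partialDeriv_iterate j (n j) ih

theorem integrableOn_mul_prod {s : ℕ} {g : (Fin s → ℝ) → ℂ} (hg : ContinuousOn g (Icc 0 1))
    {θ : Fin s → ℝ → ℂ} (hm : ∀ j, Measurable (θ j)) {B : Fin s → ℝ} (hB : ∀ j t, ‖θ j t‖ ≤ B j) :
    IntegrableOn (fun x => g x * ∏ j, θ j (x j)) (unitCube s) := by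
  refine integrableOn_unitCube hg (B := ∏ j, B j)
    (Finset.measurable_prod _ fun j _ => (hm j).comp (measurable_pi_apply j)) fun x => ?_
  rw [norm_prod]
  exact Finset.prod_le_prod (fun _ _ => norm_nonneg _) fun j _ => hB j _

/-- Coordinatewise integration by parts over the unit cube. -/
theorem integral_mul_prod_eq {s : ℕ} {f : (Fin s → ℝ) → ℂ} (hf : ContDiffOn ℝ ∞ f (Icc 0 1))
    (n : Fin s → ℕ) {ψ φ : Fin s → ℝ → ℂ} (hψ : ∀ j, Measurable (ψ j))
    (hφ : ∀ j, Measurable (φ j)) {B : Fin s → ℝ} (hψB : ∀ j t, ‖ψ j t‖ ≤ B j)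
    (hφB : ∀ j t, ‖φ j t‖ ≤ B j)
    (h : ∀ j, ∀ g : ℝ → ℂ, ContDiffOn ℝ ∞ g (Icc 0 1) →
      ∫ t in (0 : ℝ)..1, g t * ψ j t = ∫ t in (0 : ℝ)..1, derivUnit^[n j] g t * φ j t)
    {l : List (Fin s)} (hl : l.Nodup) :
    ∫ x in unitCube s, f x * ∏ j, ψ j (x j)
      = ∫ x in unitCube s, listDeriv n l f x * ∏ j, (if j ∈ l then φ j else ψ j) (x j) := by
  induction l with
  | nil => simp [listDeriv]
  | cons j l ih =>
    obtain ⟨hj, hl⟩ := List.nodup_cons.1 hl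
    have hm (l : List (Fin s)) (i : Fin s) : Measurable (if i ∈ l then φ i else ψ i) := by
      split_ifs
      exacts [hφ i, hψ i]
    have hB (l : List (Fin s)) (i : Fin s) (t : ℝ) : ‖(if i ∈ l then φ i else ψ i) t‖ ≤ B i := by
      split_ifs
      exacts [hφB i t, hψB i t]
    have hg := contDiffOn_listDeriv n l hf
    rw [ih hl]
    refine integral_unitCube_congr_line j
      (integrableOn_mul_prod hg.continuousOn (hm l) (hB l))
      (integrableOn_mul_prod (contDiffOn_listDeriv n (j :: l) hf).continuousOn (hm _) (hB _))
      fun x hx => ?_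
    -- Along a line in direction `j` only the `j`-th factor varies, so the rest leaves the integral
    -- as a constant.
    have hprod (l : List (Fin s)) (t : ℝ) :
        ∏ i, (if i ∈ l then φ i else ψ i) (Function.update x j t i)
          = (if j ∈ l then φ j else ψ j) t *
            ∏ i ∈ Finset.univ.erase j, (if i ∈ l then φ i else ψ i) (x i) := by
      rw [← Finset.mul_prod_erase _ _ (Finset.mem_univ j), Function.update_self]
      congr 1
      refine Finset.prod_congr rfl fun i hi => ?_
      rw [Function.update_of_ne (Finset.ne_of_mem_erase hi)]
    have hrest : ∏ i ∈ Finset.univ.erase j, (if i ∈ j :: l then φ i else ψ i) (x i)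
        = ∏ i ∈ Finset.univ.erase j, (if i ∈ l then φ i else ψ i) (x i) := by
      refine Finset.prod_congr rfl fun i hi => ?_
      simp [Finset.ne_of_mem_erase hi]
    simp_rw [hprod, hrest, if_neg hj, if_pos (List.mem_cons_self (a := j)), ← mul_assoc]
    rw [intervalIntegral.integral_mul_const, intervalIntegral.integral_mul_const,
      h j _ (contDiffOn_line j hg (unitCube_subset_Icc s hx))]
    congr 2
    funext t
    rw [← partialDeriv_iterate_update]
    rfl

/-! ### Walsh functions as products of step characters -/

theorem natDigit_lt {b : ℕ} (hb : 2 ≤ b) (k i : ℕ) : natDigit b k i < b := by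
  rw [natDigit, Nat.getD_digits _ _ hb]
  exact Nat.mod_lt _ (by omega)

theorem one_le_and_natDigit_ne_zero {b k a : ℕ} (ha : a ∈ positions b k) :
    1 ≤ a ∧ natDigit b k (a - 1) ≠ 0 := by
  obtain ⟨i, hi, rfl⟩ := Finset.mem_image.1 ha
  exact ⟨by omega, by simpa using (Finset.mem_filter.1 hi).2⟩

/-- The root of unity attached to the digit of `k` at position `a`. -/
def digitRoot (b k a : ℕ) : ℂ := starRingEnd ℂ (omega b) ^ natDigit b k (a - 1)

theorem digitRoot_spec {b : ℕ} (hb : 2 ≤ b) {k a : ℕ} (ha : a ∈ positions b k) :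
    digitRoot b k a ^ b = 1 ∧ digitRoot b k a ≠ 1 := by
  have hr := isPrimitiveRoot_conj_omega (b := b) (by omega)
  refine ⟨?_, hr.pow_ne_one_of_pos_of_lt (one_le_and_natDigit_ne_zero ha).2 (natDigit_lt hb _ _)⟩
  rw [digitRoot, ← pow_mul, mul_comm, pow_mul, hr.pow_eq_one, one_pow]

/-- The digit at position `a`, which `Real.digits` indexes by `a - 1`, is `⌊b ^ a * x⌋` modulo `b`,
and `z ^ b = 1` makes the power depend only on that residue. -/
theorem stepChar_eq_pow_digit {b : ℕ} [NeZero b] {z : ℂ} (hz : z ^ b = 1) {a : ℕ} (ha : 1 ≤ a)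
    {x : ℝ} (hx : 0 ≤ x) :
    stepChar z ((b : ℝ) ^ a)⁻¹ x = z ^ (Real.digits x b (a - 1) : ℕ) := by
  have h0 : 0 ≤ x * (b : ℝ) ^ a := by positivity
  rw [stepChar, div_inv_eq_mul, ← Int.natCast_floor_eq_floor h0, zpow_natCast, Real.digits,
    Fin.val_ofNat, Nat.sub_add_cancel ha,
    ← pow_eq_pow_mod _ hz]

theorem conj_wal_eq_charProd {b : ℕ} [NeZero b] (hb : 2 ≤ b) (k : ℕ) {x : ℝ} (hx : 0 ≤ x) :
    starRingEnd ℂ (wal b k x) = charProd b (digitRoot b k) (positions b k).sort x := by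
  have e : charProd b (digitRoot b k) (positions b k).sort x
      = ∏ a ∈ positions b k, stepChar (digitRoot b k a) ((b : ℝ) ^ a)⁻¹ x := by
    rw [charProd, ← Multiset.prod_coe, ← Multiset.map_coe, Finset.sort_eq]
    rfl
  rw [e, wal, map_pow, ← Finset.prod_pow_eq_pow_sum]
  refine Finset.prod_congr rfl fun a ha => ?_
  rw [stepChar_eq_pow_digit (digitRoot_spec hb ha).1 (one_le_and_natDigit_ne_zero ha).1 hx,
    digitRoot, pow_mul]

/-- The kernel representing the `k`-th Walsh coefficient through the derivative of order
`hammingWeight b k`. -/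
def walshKernel (b k : ℕ) (x : ℝ) : ℂ :=
  (-1) ^ hammingWeight b k * walshPrimitive b (digitRoot b k) (positions b k).sort x

section walshKernel

variable {b : ℕ}

theorem digitRoot_spec_sort (hb : 2 ≤ b) (k : ℕ) (a : ℕ) (ha : a ∈ (positions b k).sort) :
    digitRoot b k a ^ b = 1 ∧ digitRoot b k a ≠ 1 :=
  digitRoot_spec hb ((Finset.mem_sort _).1 ha)

theorem continuous_walshKernel (hb : 2 ≤ b) (k : ℕ) : Continuous (walshKernel b k) :=
  continuous_const.mul (continuous_walshPrimitive (by omega) _ (digitRoot_spec_sort hb k)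
    (Finset.sortedLT_sort _).pairwise)

theorem norm_walshKernel_le (hb : 2 ≤ b) (k : ℕ) (x : ℝ) :
    ‖walshKernel b k x‖ ≤ ((b : ℝ) ^ mu b k)⁻¹ *
      ((mConst b)⁻¹ ^ hammingWeight b k * CConst b ^ min 1 (hammingWeight b k)) := by
  have := norm_walshPrimitive_le hb _ (digitRoot_spec_sort hb k)
    (Finset.sortedLT_sort _).pairwise x
  have hs : (positions b k).sort.sum = mu b k := by
    rw [← Multiset.sum_coe, Finset.sort_eq]
    exact congrArg Multiset.sum (Multiset.map_id' _).symm
  rw [hs, Finset.length_sort] at this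
  rwa [walshKernel, norm_mul, norm_pow, norm_neg, norm_one, one_pow, one_mul]

theorem norm_charProd_digitRoot (hb : 2 ≤ b) (k : ℕ) (x : ℝ) :
    ‖charProd b (digitRoot b k) (positions b k).sort x‖ = 1 :=
  norm_charProd (fun a ha => Complex.norm_eq_one_of_pow_eq_one
    (digitRoot_spec_sort hb k a ha).1 (by omega)) x

theorem integral_mul_walshKernel (hb : 2 ≤ b) (k : ℕ) {g : ℝ → ℂ} (hg : ContDiffOn ℝ ∞ g (Icc 0 1)) :
    ∫ t in (0 : ℝ)..1, g t * charProd b (digitRoot b k) (positions b k).sort t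
      = ∫ t in (0 : ℝ)..1, derivUnit^[hammingWeight b k] g t * walshKernel b k t := by
  have := integral_mul_charProd (b := b) (z := digitRoot b k) (L₁ := (positions b k).sort)
    (L₂ := []) (by omega) hg
    (fun a ha => (one_le_and_natDigit_ne_zero ((Finset.mem_sort _).1 ha)).1)
    (by simpa using digitRoot_spec_sort hb k)
    (by simpa using (Finset.sortedLT_sort _).pairwise)
  simp only [List.append_nil, Finset.length_sort] at this
  simp only [walshKernel, hammingWeight, ← mul_assoc]
  simp only [mul_comm _ ((-1 : ℂ) ^ _), mul_assoc]
  rw [intervalIntegral.integral_const_mul, ← this]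
  simp [walshPrimitive]

end walshKernel

/-- The Walsh coefficient as an integral of a mixed derivative against a product of kernels. -/
theorem walshCoeff_eq {b : ℕ} [NeZero b] (hb : 2 ≤ b) {s : ℕ} {f : (Fin s → ℝ) → ℂ}
    (hf : ContDiffOn ℝ ∞ f (Icc 0 1)) (k : Fin s → ℕ) :
    walshCoeff b f k = ∫ x in unitCube s,
      mixedDeriv (fun j => hammingWeight b (k j)) f x * ∏ j, walshKernel b (k j) (x j) := by
  have h1 : walshCoeff b f k = ∫ x in unitCube s,
      f x * ∏ j, charProd b (digitRoot b (k j)) (positions b (k j)).sort (x j) := by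
    refine setIntegral_congr_fun (measurableSet_unitCube s) fun x hx => ?_
    rw [walVec, map_prod]
    congr 1
    exact Finset.prod_congr rfl fun j _ => conj_wal_eq_charProd hb (k j) (hx j (mem_univ j)).1
  rw [h1, integral_mul_prod_eq hf (fun j => hammingWeight b (k j))
    (φ := fun j => walshKernel b (k j))
    (fun j => measurable_charProd _) (fun j => (continuous_walshKernel hb (k j)).measurable)
    -- The common bound, the maximum of `1` and the kernel bound, serves integrability only.
    (fun j t => (norm_charProd_digitRoot hb (k j) t).le.trans (le_max_left 1 _))
    (fun j t => (norm_walshKernel_le hb (k j) t).trans (le_max_right _ _))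
    (fun j g hg => integral_mul_walshKernel hb (k j) hg) (List.nodup_finRange s)]
  simp [listDeriv, mixedDeriv]

/-! ### From `L¹` bounds to the coefficient bound -/

theorem norm_integral_mul_le {s : ℕ} {g χ : (Fin s → ℝ) → ℂ} (hg : ContinuousOn g (Icc 0 1))
    {A B : ℝ} (hA : 0 ≤ A) (hgA : L1norm g ≤ ENNReal.ofReal A) (hB : ∀ x, ‖χ x‖ ≤ B) :
    ‖∫ x in unitCube s, g x * χ x‖ ≤ A * B := by
  have hi : Integrable g (volume.restrict (unitCube s)) :=
    (hg.integrableOn_compact isCompact_Icc).mono_set (unitCube_subset_Icc s)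
  have hB0 : 0 ≤ B := (norm_nonneg _).trans (hB 0)
  rw [L1norm, eLpNorm_one_eq_lintegral_enorm, ← ofReal_integral_norm_eq_lintegral_enorm hi,
    ENNReal.ofReal_le_ofReal_iff hA] at hgA
  calc _ ≤ ∫ x in unitCube s, ‖g x‖ * B :=
        norm_integral_le_of_norm_le (hi.norm.mul_const B) (Filter.Eventually.of_forall fun x => by
          rw [norm_mul]
          exact mul_le_mul_of_nonneg_left (hB x) (norm_nonneg _))
    _ = (∫ x in unitCube s, ‖g x‖) * B := integral_mul_const _ _
    _ ≤ A * B := by gcongr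

theorem norm_walshCoeff_le {b : ℕ} [NeZero b] (hb : 2 ≤ b) {s : ℕ} {f : (Fin s → ℝ) → ℂ}
    (hf : ContDiffOn ℝ ∞ f (Icc 0 1)) {r : Fin s → ℝ} (hr : ∀ j, 0 < r j) {D : ℝ} (hD : 0 < D)
    (k : Fin s → ℕ)
    (hbound : L1norm (mixedDeriv (fun j => hammingWeight b (k j)) f) ≤
      ENNReal.ofReal (D * ∏ j, r j ^ hammingWeight b (k j))) :
    ‖walshCoeff b f k‖ ≤ D * (b : ℝ) ^ (-(muVec b k : ℤ)) *
      ∏ j, (r j * (mConst b)⁻¹) ^ hammingWeight b (k j) *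
        CConst b ^ min 1 (hammingWeight b (k j)) := by
  have hpos : 0 ≤ D * ∏ j, r j ^ hammingWeight b (k j) :=
    mul_nonneg hD.le (Finset.prod_nonneg fun j _ => pow_nonneg (hr j).le _)
  rw [walshCoeff_eq hb hf]
  refine (norm_integral_mul_le (B := ∏ j, ((b : ℝ) ^ mu b (k j))⁻¹ *
      ((mConst b)⁻¹ ^ hammingWeight b (k j) * CConst b ^ min 1 (hammingWeight b (k j))))
    (contDiffOn_listDeriv _ (List.finRange s) hf).continuousOn hpos hbound
    (fun x => ?_)).trans (le_of_eq ?_)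
  · rw [norm_prod]
    exact Finset.prod_le_prod (fun _ _ => norm_nonneg _) fun j _ => norm_walshKernel_le hb _ _
  · rw [zpow_neg, zpow_natCast, muVec, ← Finset.prod_pow_eq_pow_sum, ← Finset.prod_inv_distrib,
      mul_assoc, mul_assoc, ← Finset.prod_mul_distrib, ← Finset.prod_mul_distrib]
    congr 1
    refine Finset.prod_congr rfl fun j _ => ?_
    rw [mul_pow]
    ring

end WalshDecay

end

theorem mainTheorem10 (b : ℕ) [NeZero b] (hb : 2 ≤ b) (s : ℕ) (f : (Fin s → ℝ) → ℂ)
    (hf : ContDiffOn ℝ ∞ f (Set.Icc 0 1)) (r : Fin s → ℝ) (hr : ∀ j, 0 < r j)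
    (D : ℝ) (hD : 0 < D)
    (hbound : ∀ n : Fin s → ℕ,
      WalshDecay.L1norm (WalshDecay.mixedDeriv n f) ≤ ENNReal.ofReal (D * ∏ j, r j ^ n j)) :
    (∀ k : Fin s → ℕ,
      ‖WalshDecay.walshCoeff b f k‖ ≤
        D * (b : ℝ) ^ (-(WalshDecay.muVec b k : ℤ)) *
          ∏ j, (r j * (WalshDecay.mConst b)⁻¹) ^ WalshDecay.hammingWeight b (k j) *
            WalshDecay.CConst b ^ min 1 (WalshDecay.hammingWeight b (k j))) ∧
    ((∀ j, r j = WalshDecay.mConst b) →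
      Asymptotics.IsBigO ⊤ (fun k : Fin s → ℕ => WalshDecay.walshCoeff b f k)
        (fun k : Fin s → ℕ => (b : ℝ) ^ (-(WalshDecay.muVec b k : ℤ)))) := by
  have main (k : Fin s → ℕ) := WalshDecay.norm_walshCoeff_le hb hf hr hD k (hbound _)
  refine ⟨main, fun hrm => ?_⟩
  -- When `r j = m_b`, coordinate `j` contributes `1` or `C_b` according to whether `k j` has a
  -- nonzero digit; the maximum dominates both, uniformly in `k`.
  refine Asymptotics.IsBigO.of_bound (D * ∏ _j : Fin s, max 1 |WalshDecay.CConst b|)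
    (Filter.Eventually.of_forall fun k => (main k).trans ?_)
  have hz : 0 ≤ (b : ℝ) ^ (-(WalshDecay.muVec b k : ℤ)) := by positivity
  rw [Real.norm_of_nonneg hz, mul_right_comm]
  refine mul_le_mul_of_nonneg_right (mul_le_mul_of_nonneg_left ?_ hD.le) hz
  refine (le_abs_self _).trans ?_
  rw [Finset.abs_prod]
  refine Finset.prod_le_prod (fun _ _ => abs_nonneg _) fun j _ => ?_
  rw [hrm j, mul_inv_cancel₀ (WalshDecay.mConst_pos hb).ne', one_pow, one_mul, abs_pow]
  rcases Nat.eq_zero_or_pos (WalshDecay.hammingWeight b (k j)) with h | h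
  · simp [h]
  · rw [min_eq_left h, pow_one]
    exact le_max_right _ _
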